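/- Let $d \ge 1$, let $\mathcal I$ be a nonempty set which is finite or countably infinite, and let $\mathsf A=(A_i)_{i\in\mathcal I}$ be a tuple of invertible real $d\times d$ matrices with $\sup_{i\in\mathcal I}\|A_i\|<\tfrac12$, where $\|\cdot\|$ is the operator norm induced by the Euclidean norm. For a real $d \times d$ matrix $A$ with singular values $\sigma_1(A)\ge\dots\ge\sigma_d(A)$ and $s\ge0$ put $\varphi^s(A)=\sigma_1(A)\cdots\sigma_{\lfloor s\rfloor}(A)\,\sigma_{\lceil s\rceil}(A)^{s-\lfloor s\rfloor}$ if $s\le d$ and $\varphi^s(A)=|\det A|^{s/d}$ if $s>d$. For a nonempty finite set $\mathcal J\subseteq\mathcal I$ let $$P_{\mathcal J}(s)=\lim_{n\to\infty}\frac1n\log\sum_{(i_1,\dots,i_n)\in\mathcal J^n}\varphi^s(A_{i_1}\cdots A_{i_n}),$$ and define the lower affinity dimension of $\mathsf A$ by $$\underline{\dim}_{\mathrm{aff}}\,\mathsf A=\sup\bigl\{\inf\{s\ge0: P_{\mathcal J}(s)<0\} : \mathcal J\subseteq\mathcal I \text{ nonempty and finite}\bigr\}\in[0,\infty].$$ For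 $\mathsf v=(v_i)_{i\in\mathcal I}\in\mathbf Q=([0,1]^d)^{\mathcal I}$ let $T_i(x)=A_ix+v_i$, and let $X_{\mathsf v}\subset\mathbb R^d$ be the self-affine set (limit set) of $(T_i)_{i\in\mathcal I}$, that is, the set of all $x\in\mathbb R^d$ for which there is a sequence $(i_n)_{n\ge1}$ in $\mathcal I$ such that $\lim_{n\to\infty}T_{i_1}\circ\cdots\circ T_{i_n}(y)=x$ for every $y\in\mathbb R^d$. Let $\mathcal L_{\mathbf Q}$ be the product probability measure on $\mathbf Q$ each of whose factors is Lebesgue measure on $[0,1]^d$. Then $$\dim_{\mathrm H}X_{\mathsf v}\ \ge\ \min\{d,\ \underline{\dim}_{\mathrm{aff}}\,\mathsf A\}\qquad\text{for }\mathcal L_{\mathbf Q}\text{-almost every }\mathsf v\in\mathbf Q.$$ -/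

import Mathlib

open MeasureTheory Filter Topology
open scoped ENNReal NNReal

noncomputable section

namespace SelfAffine

/-- `σ_{k+1}(M)`: the singular values of `M` in non-increasing order, indexed from `0`. -/
def singularValue {d : ℕ} (M : Matrix (Fin d) (Fin d) ℝ) (k : ℕ) : ℝ :=
  (Matrix.toEuclideanLin M).singularValues k

/-- The singular value function `φ^s(M)`. The singular values are indexed from `0`, so for
non-integer `s` the factor `σ_{⌈s⌉}` is the one of index `⌊s⌋`; for integer `s` its exponent
is `0`. -/
def svf {d : ℕ} (s : ℝ≥0) (M : Matrix (Fin d) (Fin d) ℝ) : ℝ :=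
  if s ≤ d then
    (∏ k ∈ Finset.range ⌊s⌋₊, singularValue M k) *
      singularValue M ⌊s⌋₊ ^ ((s : ℝ) - (⌊s⌋₊ : ℝ))
  else |M.det| ^ ((s : ℝ) / (d : ℝ))

/-- `A_{i_1} ⋯ A_{i_n}` for the word `w = (i_1, …, i_n)`. -/
def wordProd {d : ℕ} {ι : Type*} (A : ι → GL (Fin d) ℝ) {n : ℕ} (w : Fin n → ι) :
    GL (Fin d) ℝ :=
  (List.ofFn fun k => A (w k)).prod

/-- `∑_{(i_1, …, i_n)} φ^s(A_{i_1} ⋯ A_{i_n})`, with values in `[0, ∞]`. -/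
def svfSum {d : ℕ} {ι : Type*} (A : ι → GL (Fin d) ℝ) (s : ℝ≥0) (n : ℕ) : ℝ≥0∞ :=
  ∑' w : Fin n → ι, ENNReal.ofReal (svf s (wordProd A w : Matrix (Fin d) (Fin d) ℝ))

/-- The pressure `P(A, s)`, with values in the extended reals. The limit of
`(1 / n) log ∑ φ^s` always exists, so it is the upper limit. -/
def pressure {d : ℕ} {ι : Type*} (A : ι → GL (Fin d) ℝ) (s : ℝ≥0) : EReal :=
  limsup (fun n : ℕ => ENNReal.log (svfSum A s n) / (n : EReal)) atTop

/-- The upper affinity dimension `inf {s ≥ 0 : P(A, s) < 0}`, where `inf ∅ = ∞`. -/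
def upperAffinityDim {d : ℕ} {ι : Type*} (A : ι → GL (Fin d) ℝ) : ℝ≥0∞ :=
  ⨅ (s : ℝ≥0) (_ : pressure A s < 0), (s : ℝ≥0∞)

/-- The lower affinity dimension: the supremum of the upper affinity dimensions of the
nonempty finite subtuples. -/
def lowerAffinityDim {d : ℕ} {ι : Type*} (A : ι → GL (Fin d) ℝ) : ℝ≥0∞ :=
  ⨆ (J : Finset ι) (_ : J.Nonempty), upperAffinityDim (fun i : J => A i)

/-- The affine map `T_i(x) = A_i x + v_i`. -/
def affineMap {d : ℕ} {ι : Type*} (A : ι → GL (Fin d) ℝ)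
    (v : ι → EuclideanSpace ℝ (Fin d)) (i : ι) (x : EuclideanSpace ℝ (Fin d)) :
    EuclideanSpace ℝ (Fin d) :=
  Matrix.toEuclideanLin (A i : Matrix (Fin d) (Fin d) ℝ) x + v i

/-- `S 0 ∘ S 1 ∘ ⋯ ∘ S (n - 1)`. -/
def iterComp {X : Type*} (S : ℕ → X → X) : ℕ → X → X
  | 0 => id
  | n + 1 => iterComp S n ∘ S n

/-- The self-affine set `X_v`, that is, the set of all limit points of the system `(T_i)`:
the points `x` for which there is a sequence `(i_n)` such that
`T_{i_1} ∘ ⋯ ∘ T_{i_n} (y) → x` for every `y`. -/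
def selfAffineSet {d : ℕ} {ι : Type*} (A : ι → GL (Fin d) ℝ)
    (v : ι → EuclideanSpace ℝ (Fin d)) : Set (EuclideanSpace ℝ (Fin d)) :=
  {x | ∃ w : ℕ → ι, ∀ y : EuclideanSpace ℝ (Fin d),
    Tendsto (fun n => iterComp (fun k => affineMap A v (w k)) n y) atTop (𝓝 x)}

/-- The unit cube `[0,1]^d`. -/
def unitCube (d : ℕ) : Set (EuclideanSpace ℝ (Fin d)) :=
  {x | ∀ k, x k ∈ Set.Icc (0 : ℝ) 1}

/-- Lebesgue measure restricted to the unit cube. -/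
def cubeMeasure (d : ℕ) : Measure (EuclideanSpace ℝ (Fin d)) :=
  volume.restrict (unitCube d)

theorem volume_unitCube (d : ℕ) : volume (unitCube d) = 1 := by
  have h : unitCube d = (WithLp.ofLp : EuclideanSpace ℝ (Fin d) → (Fin d → ℝ)) ⁻¹'
      (Set.univ.pi fun _ => Set.Icc (0 : ℝ) 1) := by
    ext x
    simp only [unitCube, Set.mem_ofPred_eq, Set.mem_preimage, Set.mem_univ_pi]
  rw [h, (PiLp.volume_preserving_ofLp (Fin d)).measure_preimage
    (MeasurableSet.univ_pi fun _ => measurableSet_Icc).nullMeasurableSet, volume_pi_pi]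
  simp

instance isProbabilityMeasure_cubeMeasure (d : ℕ) : IsProbabilityMeasure (cubeMeasure d) :=
  ⟨by rw [cubeMeasure, Measure.restrict_apply_univ, volume_unitCube]⟩

/-- The product probability measure on `([0,1]^d)^ι`, as a measure on `(ℝ^d)^ι`. -/
def translationMeasure (d : ℕ) (ι : Type*) : Measure (ι → EuclideanSpace ℝ (Fin d)) :=
  Measure.infinitePi fun _ : ι => cubeMeasure d

end SelfAffine

end

noncomputable section

namespace SelfAffine

/-! The limit set contains the limit set of every finite subsystem. A countable index set has only
countably many finite subsets, so it suffices to fix one finite `J` and show that the dimension is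
almost surely at least `τ`, for each `τ` below `d` and below the affinity dimension of `J`. Choose
`τ < t < s` with `s` still below that dimension and `⌊t⌋ = ⌊s⌋ < d`.

Symbolic side: the pressure at `s` is not negative. If the symbolic space had covers by cylinders of
arbitrarily small total weight `φ^s`, submultiplicativity would make the level sums decay
exponentially (`exists_levelSum_le_pow`). So the content is positive, and splitting it down the tree
of words gives a Frostman measure `μ` with `μ[w] ≤ C φ^s(A_w)` (`exists_measure_le_svfWeight`).

Geometric side: if `x` and `y` first differ after the common word `w`, the difference of their coded
points is `A_w` applied to the difference for the shifted addresses. As a function of one suitable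
translation vector the latter is expanding; this is where norms below `1/2` are needed
(`exists_antilipschitzWith`). Since `{‖u‖ ≤ R, ‖A_w u‖ ≤ r}` has volume at most `C r^t / φ^t(A_w)`,
the coded points are `r`-close with probability at most `C r^t / φ^t(A_w)`.

Integrating over `y` gives `∑ₙ C φ^s / φ^t` along the prefixes of `x`, which is at most a geometric
series with ratio `α^(s-t)`. By Tonelli the image of `μ` almost surely has finite `τ`-potential
almost everywhere, so its support set has dimension at least `τ`.

Singular values enter only through volumes of such sets `{‖u‖ ≤ R, ‖T u‖ ≤ r}`; even the
submultiplicativity of `φ^s`, up to a constant, is obtained from them. -/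

/-- The product of the `m` largest singular values. -/
def singularProd {d : ℕ} (T : EuclideanSpace ℝ (Fin d) →ₗ[ℝ] EuclideanSpace ℝ (Fin d)) (m : ℕ) :
    ℝ :=
  ∏ k ∈ Finset.range m, T.singularValues k

/-! ### Singular values through volumes -/

section SingularValues

variable {d : ℕ} {T : EuclideanSpace ℝ (Fin d) →ₗ[ℝ] EuclideanSpace ℝ (Fin d)}

theorem singularValues_pos (hT : Function.Injective T) {i : ℕ} (hi : i < d) :
    0 < T.singularValues i :=
  T.injective_iff_forall_lt_finrank_singularValues_pos.1 hT i (by simpa using hi)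

theorem singularProd_pos (hT : Function.Injective T) {m : ℕ} (hm : m ≤ d) :
    0 < singularProd T m :=
  Finset.prod_pos fun _ hk => singularValues_pos hT ((Finset.mem_range.1 hk).trans_le hm)

/-- Eigenvectors of `T* T` diagonalise the quadratic form `‖T u‖ ^ 2`. In this basis, conditions on
`‖u‖` and `‖T u‖` become conditions on coordinates, up to constants, so volumes reduce to volumes of
boxes. -/
theorem exists_orthonormalBasis_norm_sq_eq
    (T : EuclideanSpace ℝ (Fin d) →ₗ[ℝ] EuclideanSpace ℝ (Fin d)) :
    ∃ e : OrthonormalBasis (Fin d) ℝ (EuclideanSpace ℝ (Fin d)),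
      ∀ u, ‖T u‖ ^ 2 = ∑ i : Fin d, (T.singularValues i * e.repr u i) ^ 2 := by
  have hn : Module.finrank ℝ (EuclideanSpace ℝ (Fin d)) = d := by simp
  have hS := T.isSymmetric_adjoint_comp_self
  refine ⟨hS.eigenvectorBasis hn, fun u => ?_⟩
  have h1 : ‖T u‖ ^ 2 = inner ℝ u ((T.adjoint ∘ₗ T) u) := by
    rw [LinearMap.comp_apply, LinearMap.adjoint_inner_right, real_inner_self_eq_norm_sq]
  rw [h1, ← (hS.eigenvectorBasis hn).sum_inner_mul_inner]
  refine Finset.sum_congr rfl fun i _ => ?_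
  rw [mul_pow, T.sq_singularValues_fin hn i, ← hS _ u, hS.apply_eigenvectorBasis,
    OrthonormalBasis.repr_apply_apply, inner_smul_left, real_inner_comm]
  simp
  ring

theorem singularValues_le_of_norm_le {a : ℝ} (ha : ∀ u, ‖T u‖ ≤ a * ‖u‖) {k : ℕ} (hk : k < d) :
    T.singularValues k ≤ a := by
  obtain ⟨e, he⟩ := exists_orthonormalBasis_norm_sq_eq T
  have h1 := he (e ⟨k, hk⟩)
  rw [Finset.sum_eq_single (⟨k, hk⟩ : Fin d)] at h1
  · simp only [OrthonormalBasis.repr_self, PiLp.single_apply, if_true, mul_one] at h1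
    have h2 := ha (e ⟨k, hk⟩)
    rw [e.norm_eq_one, mul_one] at h2
    have h3 : ‖T (e ⟨k, hk⟩)‖ = T.singularValues k :=
      (pow_left_inj₀ (norm_nonneg _) (T.singularValues_nonneg k) two_ne_zero).1 h1
    rwa [← h3]
  · intro i _ hi
    simp [OrthonormalBasis.repr_self, hi]
  · simp

theorem volume_preimage_repr_box (e : OrthonormalBasis (Fin d) ℝ (EuclideanSpace ℝ (Fin d)))
    (b : Fin d → ℝ) :
    volume {u : EuclideanSpace ℝ (Fin d) | ∀ i, |e.repr u i| ≤ b i} =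
      ENNReal.ofReal (∏ i, 2 * max (b i) 0) := by
  have h : {u : EuclideanSpace ℝ (Fin d) | ∀ i, |e.repr u i| ≤ b i} =
      e.repr ⁻¹' ((WithLp.ofLp : EuclideanSpace ℝ (Fin d) → (Fin d → ℝ)) ⁻¹'
        (Set.univ.pi fun i => Set.Icc (-b i) (b i))) := by
    ext u
    simp only [abs_le, Set.mem_ofPred_eq, Set.mem_preimage, Set.mem_univ_pi, Set.mem_Icc]
  have hm : MeasurableSet (Set.univ.pi fun i => Set.Icc (-b i) (b i)) :=
    MeasurableSet.univ_pi fun _ => measurableSet_Icc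
  rw [h, e.measurePreserving_repr.measure_preimage
      ((PiLp.volume_preserving_ofLp (Fin d)).measurable hm).nullMeasurableSet,
    (PiLp.volume_preserving_ofLp (Fin d)).measure_preimage hm.nullMeasurableSet, volume_pi_pi,
    ENNReal.ofReal_prod_of_nonneg fun _ _ => by positivity]
  refine Finset.prod_congr rfl fun i _ => ?_
  rw [Real.volume_Icc]
  rcases le_total (b i) 0 with h | h
  · rw [max_eq_right h, mul_zero, ENNReal.ofReal_zero, ENNReal.ofReal_eq_zero]
    linarith
  · rw [max_eq_left h]
    congr 1
    ring

theorem prod_fin_ite_lt {m : ℕ} (hm : m ≤ d) (f : ℕ → ℝ) (a : ℝ) :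
    ∏ i : Fin d, (if (i : ℕ) < m then f i else a) =
      (∏ k ∈ Finset.range m, f k) * a ^ (d - m) := by
  rw [Fin.prod_univ_eq_prod_range (fun i => if i < m then f i else a) d,
    ← Nat.add_sub_cancel' hm, Finset.prod_range_add]
  congr 1
  · exact Finset.prod_congr rfl fun k hk => if_pos (Finset.mem_range.1 hk)
  · simp

theorem norm_repr_le (e : OrthonormalBasis (Fin d) ℝ (EuclideanSpace ℝ (Fin d)))
    (u : EuclideanSpace ℝ (Fin d)) (i : Fin d) : |e.repr u i| ≤ ‖u‖ := by
  rw [← e.repr.norm_map u]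
  exact PiLp.norm_apply_le (e.repr u) i

/-- The part of a ball that `T` maps into the ball of radius `r` has volume at most
`C r ^ m / (σ₁ ⋯ σₘ)`. -/
theorem volume_ball_inter_preimage_le (hT : Function.Injective T) {m : ℕ} (hm : m ≤ d)
    {R r : ℝ} (hR : 1 ≤ R) (hr : 0 ≤ r) :
    volume {u : EuclideanSpace ℝ (Fin d) | ‖u‖ ≤ R ∧ ‖T u‖ ≤ r} ≤
      ENNReal.ofReal ((2 * R) ^ d * (r ^ m / singularProd T m)) := by
  obtain ⟨e, he⟩ := exists_orthonormalBasis_norm_sq_eq T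
  set b : Fin d → ℝ := fun i => if (i : ℕ) < m then r / T.singularValues i else R with hb
  have hb0 : ∀ i, 0 ≤ b i := by
    intro i
    simp only [hb]
    split_ifs
    · exact div_nonneg hr (T.singularValues_nonneg _)
    · linarith
  have hsub : {u : EuclideanSpace ℝ (Fin d) | ‖u‖ ≤ R ∧ ‖T u‖ ≤ r} ⊆
      {u | ∀ i, |e.repr u i| ≤ b i} := by
    rintro u ⟨hu, hTu⟩ i
    simp only [hb]
    split_ifs with hi
    · have hpos := singularValues_pos hT i.2
      rw [le_div_iff₀ hpos]
      refine le_trans ?_ hTu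
      refine abs_le_of_sq_le_sq' ?_ (norm_nonneg _) |>.2
      rw [he u, mul_comm, mul_pow, sq_abs, ← mul_pow]
      exact Finset.single_le_sum (f := fun i : Fin d => (T.singularValues i * e.repr u i) ^ 2)
        (fun _ _ => sq_nonneg _) (Finset.mem_univ i)
    · exact (norm_repr_le e u i).trans hu
  refine (measure_mono hsub).trans ?_
  rw [volume_preimage_repr_box]
  refine ENNReal.ofReal_le_ofReal ?_
  have h1 : ∀ i, max (b i) 0 = b i := fun i => max_eq_left (hb0 i)
  simp only [h1, Finset.prod_mul_distrib, Finset.prod_const, Finset.card_univ, Fintype.card_fin]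
  rw [hb, prod_fin_ite_lt hm (fun k => r / T.singularValues k) R, Finset.prod_div_distrib,
    Finset.prod_const, Finset.card_range, mul_pow, mul_assoc]
  have h2 : R ^ (d - m) ≤ R ^ d := pow_le_pow_right₀ hR (Nat.sub_le _ _)
  have h3 : 0 ≤ r ^ m / singularProd T m := div_nonneg (pow_nonneg hr _) (singularProd_pos hT hm).le
  have := mul_le_mul_of_nonneg_left h2 h3
  unfold singularProd at *
  nlinarith [pow_pos (two_pos (α := ℝ)) d]

/-- At the critical radius `r = σ_{m+1}` the box with half-sides `min (1, r / σ_i) / d` fits inside,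
so the upper bound is sharp up to a constant: the volume determines `σ₁ ⋯ σ_{m+1}`. -/
theorem le_volume_ball_inter_preimage (hT : Function.Injective T) {m : ℕ} (hm : m < d) :
    ENNReal.ofReal ((2 / d : ℝ) ^ d *
        (T.singularValues m ^ (m + 1) / singularProd T (m + 1))) ≤
      volume {u : EuclideanSpace ℝ (Fin d) | ‖u‖ ≤ 1 ∧ ‖T u‖ ≤ T.singularValues m} := by
  obtain ⟨e, he⟩ := exists_orthonormalBasis_norm_sq_eq T
  have hd : (0 : ℝ) < d := by exact_mod_cast (Nat.zero_le m).trans_lt hm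
  have hd1 : (1 : ℝ) ≤ d := by exact_mod_cast (Nat.zero_le m).trans_lt hm
  set r := T.singularValues m with hr
  have hr0 : 0 ≤ r := T.singularValues_nonneg m
  set b : Fin d → ℝ := fun i => if (i : ℕ) < m + 1 then r / T.singularValues i else 1 with hb
  have hb0 : ∀ i, 0 ≤ b i := by
    intro i
    simp only [hb]
    split_ifs
    · exact div_nonneg hr0 (T.singularValues_nonneg _)
    · exact zero_le_one
  have hb1 : ∀ i, b i ≤ 1 := by
    intro i
    simp only [hb]
    split_ifs with hi
    · exact div_le_one_of_le₀ (T.singularValues_antitone (Nat.le_of_lt_succ hi))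
        (T.singularValues_nonneg _)
    · exact le_rfl
  have hbr : ∀ i : Fin d, T.singularValues i * b i ≤ r := by
    intro i
    simp only [hb]
    split_ifs with hi
    · rw [mul_div_cancel₀ _ (singularValues_pos hT i.2).ne']
    · rw [mul_one]
      exact T.singularValues_antitone (by omega)
  -- Dividing the half-sides by `d` turns coordinatewise bounds into Euclidean ones.
  have key : ∀ (x : Fin d → ℝ) (a : ℝ), 0 ≤ a → (∀ i, |x i| ≤ a / d) →
      ∑ i, x i ^ 2 ≤ a ^ 2 := by
    intro x a ha hx
    calc ∑ i, x i ^ 2 ≤ ∑ _i : Fin d, (a / d) ^ 2 := Finset.sum_le_sum fun i _ => by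
          rw [← sq_abs]; exact pow_le_pow_left₀ (abs_nonneg _) (hx i) 2
      _ = a ^ 2 / d := by
          simp only [Finset.sum_const, Finset.card_univ, Fintype.card_fin, nsmul_eq_mul]
          field_simp
      _ ≤ a ^ 2 := div_le_self (sq_nonneg a) hd1
  have hsub : {u : EuclideanSpace ℝ (Fin d) | ∀ i, |e.repr u i| ≤ b i / d} ⊆
      {u | ‖u‖ ≤ 1 ∧ ‖T u‖ ≤ r} := by
    intro u hu
    constructor
    · refine abs_le_of_sq_le_sq' ?_ zero_le_one |>.2
      rw [← e.repr.norm_map u, EuclideanSpace.norm_sq_eq]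
      simp only [Real.norm_eq_abs, sq_abs]
      exact key _ 1 zero_le_one fun i => (hu i).trans (by gcongr; exact hb1 i)
    · refine abs_le_of_sq_le_sq' ?_ hr0 |>.2
      rw [he u]
      refine key _ r hr0 fun i => ?_
      rw [abs_mul, abs_of_nonneg (T.singularValues_nonneg i)]
      calc T.singularValues i * |e.repr u i| ≤ T.singularValues i * (b i / d) :=
            mul_le_mul_of_nonneg_left (hu i) (T.singularValues_nonneg i)
        _ = T.singularValues i * b i / d := by ring
        _ ≤ r / d := by gcongr; exact hbr i
  refine le_trans (le_of_eq ?_) (measure_mono hsub)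
  rw [volume_preimage_repr_box]
  congr 1
  have h1 : ∀ i, 2 * max (b i / d) 0 = 2 / d * b i := fun i => by
    rw [max_eq_left (div_nonneg (hb0 i) hd.le)]; ring
  simp only [h1, Finset.prod_mul_distrib, Finset.prod_const, Finset.card_univ, Fintype.card_fin]
  rw [hb, prod_fin_ite_lt hm (fun k => r / T.singularValues k) 1, Finset.prod_div_distrib,
    Finset.prod_const, Finset.card_range, one_pow, mul_one, singularProd]

theorem measurableSet_ball_inter_preimage
    (T : EuclideanSpace ℝ (Fin d) →ₗ[ℝ] EuclideanSpace ℝ (Fin d)) (R r : ℝ) :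
    MeasurableSet {u : EuclideanSpace ℝ (Fin d) | ‖u‖ ≤ R ∧ ‖T u‖ ≤ r} := by
  have hc : Continuous T := T.continuous_of_finiteDimensional
  exact ((isClosed_le continuous_norm continuous_const).inter
    (isClosed_le hc.norm continuous_const)).measurableSet

/-- Averaging over translates shows that the volumes of the sets `{‖u‖ ≤ 1, ‖T u‖ ≤ r}` are
supermultiplicative in `T`. -/
theorem volume_mul_volume_le (A B : EuclideanSpace ℝ (Fin d) →ₗ[ℝ] EuclideanSpace ℝ (Fin d))
    (r : ℝ) :
    volume {u : EuclideanSpace ℝ (Fin d) | ‖u‖ ≤ 1 ∧ ‖B u‖ ≤ 1} *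
        volume {y : EuclideanSpace ℝ (Fin d) | ‖y‖ ≤ 1 ∧ ‖A y‖ ≤ r} ≤
      volume (Metric.closedBall (0 : EuclideanSpace ℝ (Fin d)) 2) *
        volume {u : EuclideanSpace ℝ (Fin d) | ‖u‖ ≤ 2 ∧ ‖(A ∘ₗ B) u‖ ≤ 2 * r} := by
  set X := {u : EuclideanSpace ℝ (Fin d) | ‖u‖ ≤ 1 ∧ ‖B u‖ ≤ 1} with hX
  set S := {y : EuclideanSpace ℝ (Fin d) | ‖y‖ ≤ 1 ∧ ‖A y‖ ≤ r} with hS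
  set U := {u : EuclideanSpace ℝ (Fin d) | ‖u‖ ≤ 2 ∧ ‖(A ∘ₗ B) u‖ ≤ 2 * r} with hU
  have hXm : MeasurableSet X := measurableSet_ball_inter_preimage B 1 1
  have hSm : MeasurableSet S := measurableSet_ball_inter_preimage A 1 r
  have hBc : Continuous B := B.continuous_of_finiteDimensional
  -- The measure of `Z` is computed in two ways. Slices at fixed `u` are reflected translates of
  -- `S`. A slice at fixed `y` is empty unless `‖y‖ ≤ 2`, and the difference of any two of its
  -- points lies in `U`.
  set Z : Set (EuclideanSpace ℝ (Fin d) × EuclideanSpace ℝ (Fin d)) :=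
    {p | p.1 ∈ X ∧ B p.1 - p.2 ∈ S} with hZ
  have hZm : MeasurableSet Z :=
    (measurable_fst hXm).inter
      ((((hBc.comp continuous_fst).sub continuous_snd).measurable) hSm)
  have h1 : (volume.prod volume) Z = volume X * volume S := by
    rw [Measure.prod_apply hZm]
    have : ∀ u, volume (Prod.mk u ⁻¹' Z) = X.indicator (fun _ => volume S) u := by
      intro u
      by_cases hu : u ∈ X
      · have : Prod.mk u ⁻¹' Z = (fun y => B u - y) ⁻¹' S := by
          ext y; simp [hZ, hu]
        rw [this, Set.indicator_of_mem hu,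
          (Measure.measurePreserving_sub_left volume (B u)).measure_preimage hSm.nullMeasurableSet]
      · have : Prod.mk u ⁻¹' Z = ∅ := by
          ext y; simp [hZ, hu]
        rw [this, Set.indicator_of_notMem hu, measure_empty]
    simp_rw [this]
    rw [lintegral_indicator_const hXm, mul_comm]
  have h2 : (volume.prod volume) Z ≤
      volume (Metric.closedBall (0 : EuclideanSpace ℝ (Fin d)) 2) * volume U := by
    rw [Measure.prod_apply_symm hZm]
    have : ∀ y, volume ((fun u => (u, y)) ⁻¹' Z) ≤
        (Metric.closedBall (0 : EuclideanSpace ℝ (Fin d)) 2).indicator (fun _ => volume U) y := by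
      intro y
      rcases Set.eq_empty_or_nonempty ((fun u => (u, y)) ⁻¹' Z) with h | ⟨u₀, hu₀⟩
      · rw [h, measure_empty]; exact zero_le
      · obtain ⟨⟨ha, hb⟩, hc, hd⟩ := hu₀
        have hy : y ∈ Metric.closedBall (0 : EuclideanSpace ℝ (Fin d)) 2 := by
          rw [mem_closedBall_zero_iff]
          calc ‖y‖ = ‖B u₀ - (B u₀ - y)‖ := by congr 1; abel
            _ ≤ ‖B u₀‖ + ‖B u₀ - y‖ := norm_sub_le _ _
            _ ≤ 2 := by
              have : ‖B u₀‖ ≤ 1 := hb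
              have : ‖B u₀ - y‖ ≤ 1 := hc
              linarith
        rw [Set.indicator_of_mem hy]
        have hsub : (fun u => (u, y)) ⁻¹' Z ⊆ (fun u => u - u₀) ⁻¹' U := by
          rintro u ⟨⟨ha', hb'⟩, hc', hd'⟩
          simp only at ha ha' hd hd'
          refine ⟨(norm_sub_le _ _).trans (by linarith), ?_⟩
          have : (A ∘ₗ B) (u - u₀) = A (B u - y) - A (B u₀ - y) := by
            rw [← map_sub, LinearMap.comp_apply, map_sub]; congr 1; abel
          rw [this]
          exact (norm_sub_le _ _).trans (by linarith)
        refine (measure_mono hsub).trans (le_of_eq ?_)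
        exact (measurePreserving_sub_right volume u₀).measure_preimage
          (measurableSet_ball_inter_preimage _ 2 (2 * r)).nullMeasurableSet
    refine (lintegral_mono this).trans (le_of_eq ?_)
    rw [lintegral_indicator_const measurableSet_closedBall, mul_comm]
  exact h1 ▸ h2

/-- Both factors are taken at their critical radii, where the volumes are comparable to `a^(m+1) /
(σ₁ ⋯ σ_{m+1})`. The powers of the radii then cancel and only the products of singular values
remain. -/
theorem exists_singularProd_comp_le (d m : ℕ) (hm : m ≤ d) :
    ∃ K : ℝ, 0 < K ∧ ∀ A B : EuclideanSpace ℝ (Fin d) →ₗ[ℝ] EuclideanSpace ℝ (Fin d),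
      Function.Injective A → Function.Injective B →
        singularProd (A ∘ₗ B) m ≤ K * (singularProd A m * singularProd B m) := by
  rcases m with _ | m
  · exact ⟨1, one_pos, fun A B _ _ => by simp [singularProd]⟩
  have hd : (0 : ℝ) < d := by exact_mod_cast (Nat.zero_le m).trans_lt hm
  set V := (volume (Metric.closedBall (0 : EuclideanSpace ℝ (Fin d)) 2)).toReal with hV
  set c := (2 / d : ℝ) ^ d with hc
  have hc0 : 0 < c := by positivity
  have hVt : volume (Metric.closedBall (0 : EuclideanSpace ℝ (Fin d)) 2) = ENNReal.ofReal V := by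
    rw [hV, ENNReal.ofReal_toReal measure_closedBall_lt_top.ne]
  have hV0 : 0 < V := by
    rw [hV]
    exact ENNReal.toReal_pos (Metric.measure_closedBall_pos volume _ two_pos).ne'
      measure_closedBall_lt_top.ne
  -- `V` comes from averaging over the ball of radius `2`, the powers of `2` from the upper bound at
  -- `R = 2`, `r = 2ab`, and `c * c` from the two lower bounds.
  refine ⟨V * ((2 * 2) ^ d * 2 ^ (m + 1)) / (c * c), by positivity, fun A B hA hB => ?_⟩
  set a := A.singularValues m with ha
  set b := B.singularValues m with hb
  have ha0 : 0 < a := singularValues_pos hA hm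
  have hb0 : 0 < b := singularValues_pos hB hm
  have hAB : Function.Injective (A ∘ₗ B) := by
    rw [LinearMap.coe_comp]; exact hA.comp hB
  -- Rescaling by `b⁻¹` moves the critical radius of `B` to `1`.
  have h1 := volume_mul_volume_le A (b⁻¹ • B) a
  have e1 : {u : EuclideanSpace ℝ (Fin d) | ‖u‖ ≤ 1 ∧ ‖(b⁻¹ • B) u‖ ≤ 1} =
      {u | ‖u‖ ≤ 1 ∧ ‖B u‖ ≤ b} := by
    ext u
    simp only [LinearMap.smul_apply, norm_smul, norm_inv, Real.norm_eq_abs, abs_of_pos hb0,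
      Set.mem_ofPred_eq, inv_mul_le_iff₀ hb0, mul_one]
  have e2 : {u : EuclideanSpace ℝ (Fin d) | ‖u‖ ≤ 2 ∧ ‖(A ∘ₗ (b⁻¹ • B)) u‖ ≤ 2 * a} =
      {u | ‖u‖ ≤ 2 ∧ ‖(A ∘ₗ B) u‖ ≤ 2 * (a * b)} := by
    ext u
    simp only [LinearMap.comp_smul, LinearMap.smul_apply, norm_smul, norm_inv, Real.norm_eq_abs,
      abs_of_pos hb0, Set.mem_ofPred_eq, inv_mul_le_iff₀ hb0]
    rw [show b * (2 * a) = 2 * (a * b) by ring]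
  rw [e1, e2, hVt] at h1
  have h2 := (mul_le_mul' (le_volume_ball_inter_preimage hB hm)
    (le_volume_ball_inter_preimage hA hm)).trans (h1.trans (mul_le_mul_right
      (volume_ball_inter_preimage_le hAB hm one_le_two (r := 2 * (a * b)) (by positivity)) _))
  have hPA := singularProd_pos hA hm
  have hPB := singularProd_pos hB hm
  have hPAB := singularProd_pos hAB hm
  rw [← ENNReal.ofReal_mul (by positivity), ← ENNReal.ofReal_mul hV0.le,
    ENNReal.ofReal_le_ofReal_iff (by positivity), ← ha, ← hb, ← hc] at h2
  have h3 : (c * (b ^ (m + 1) / singularProd B (m + 1))) *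
      (c * (a ^ (m + 1) / singularProd A (m + 1))) =
      (c * c * (a * b) ^ (m + 1)) / (singularProd A (m + 1) * singularProd B (m + 1)) := by
    rw [mul_pow]; field_simp
  have h4 : V * ((2 * 2) ^ d * ((2 * (a * b)) ^ (m + 1) / singularProd (A ∘ₗ B) (m + 1))) =
      (V * ((2 * 2) ^ d * 2 ^ (m + 1)) * (a * b) ^ (m + 1)) / singularProd (A ∘ₗ B) (m + 1) := by
    rw [mul_pow 2 (a * b)]; field_simp
  rw [h3, h4, div_le_div_iff₀ (by positivity) hPAB] at h2
  rw [div_mul_eq_mul_div, le_div_iff₀ (by positivity)]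
  have h5 : 0 < (a * b) ^ (m + 1) := by positivity
  nlinarith

end SingularValues

/-! ### The singular value function -/

section SingularValueFunction

variable {d : ℕ}

theorem toEuclideanLin_injective (M : GL (Fin d) ℝ) :
    Function.Injective (Matrix.toEuclideanLin (M : Matrix (Fin d) (Fin d) ℝ)) := by
  have h : Matrix.toEuclideanLin ((M⁻¹ : GL (Fin d) ℝ) : Matrix (Fin d) (Fin d) ℝ) ∘ₗ
      Matrix.toEuclideanLin (M : Matrix (Fin d) (Fin d) ℝ) = LinearMap.id := by
    rw [← Matrix.toLpLin_mul_same, ← Units.val_mul, inv_mul_cancel, Units.val_one,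
      Matrix.toLpLin_one]
  exact Function.LeftInverse.injective
    (g := Matrix.toEuclideanLin ((M⁻¹ : GL (Fin d) ℝ) : Matrix (Fin d) (Fin d) ℝ))
    fun x => LinearMap.congr_fun h x

theorem svf_eq {s : ℝ≥0} (hs : ⌊s⌋₊ < d) (M : Matrix (Fin d) (Fin d) ℝ) :
    svf s M = singularProd (Matrix.toEuclideanLin M) ⌊s⌋₊ *
      (Matrix.toEuclideanLin M).singularValues ⌊s⌋₊ ^ ((s : ℝ) - (⌊s⌋₊ : ℝ)) := by
  have h : s ≤ d := (Nat.lt_floor_add_one s).le.trans (by exact_mod_cast hs)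
  rw [svf, if_pos h]
  rfl

/-- `φ^s` is a geometric mean of two products of singular values, so bounds at the two neighbouring
integers interpolate. -/
theorem svf_eq_rpow {s : ℝ≥0} (hs : ⌊s⌋₊ < d) (M : GL (Fin d) ℝ) :
    svf s (M : Matrix (Fin d) (Fin d) ℝ) =
      singularProd (Matrix.toEuclideanLin (M : Matrix (Fin d) (Fin d) ℝ)) ⌊s⌋₊ ^
          (1 - ((s : ℝ) - ⌊s⌋₊)) *
        singularProd (Matrix.toEuclideanLin (M : Matrix (Fin d) (Fin d) ℝ)) (⌊s⌋₊ + 1) ^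
          ((s : ℝ) - ⌊s⌋₊) := by
  have h1 := singularProd_pos (toEuclideanLin_injective M) hs.le
  have h2 := singularValues_pos (toEuclideanLin_injective M) hs
  have h3 : singularProd (Matrix.toEuclideanLin (M : Matrix (Fin d) (Fin d) ℝ)) (⌊s⌋₊ + 1) =
      singularProd (Matrix.toEuclideanLin (M : Matrix (Fin d) (Fin d) ℝ)) ⌊s⌋₊ *
        (Matrix.toEuclideanLin (M : Matrix (Fin d) (Fin d) ℝ)).singularValues ⌊s⌋₊ :=
    Finset.prod_range_succ _ _
  rw [svf_eq hs, h3, Real.mul_rpow h1.le h2.le, ← mul_assoc, ← Real.rpow_add h1]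
  simp

theorem svf_pos {s : ℝ≥0} (hs : ⌊s⌋₊ < d) (M : GL (Fin d) ℝ) :
    0 < svf s (M : Matrix (Fin d) (Fin d) ℝ) := by
  rw [svf_eq hs]
  exact mul_pos (singularProd_pos (toEuclideanLin_injective M) hs.le)
    (Real.rpow_pos_of_pos (singularValues_pos (toEuclideanLin_injective M) hs) _)

theorem floor_le_coe (s : ℝ≥0) : (⌊s⌋₊ : ℝ) ≤ s := by
  exact_mod_cast Nat.floor_le (zero_le (a := s))

theorem coe_le_floor_add_one (s : ℝ≥0) : (s : ℝ) ≤ ⌊s⌋₊ + 1 := by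
  exact_mod_cast (Nat.lt_floor_add_one s).le

theorem exists_svf_mul_le {s : ℝ≥0} (hs : ⌊s⌋₊ < d) :
    ∃ K : ℝ, 0 < K ∧ ∀ M N : GL (Fin d) ℝ,
      svf s ((M * N : GL (Fin d) ℝ) : Matrix (Fin d) (Fin d) ℝ) ≤
        K * (svf s (M : Matrix (Fin d) (Fin d) ℝ) * svf s (N : Matrix (Fin d) (Fin d) ℝ)) := by
  obtain ⟨K₁, hK₁, h₁⟩ := exists_singularProd_comp_le d ⌊s⌋₊ hs.le
  obtain ⟨K₂, hK₂, h₂⟩ := exists_singularProd_comp_le d (⌊s⌋₊ + 1) hs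
  refine ⟨K₁ ^ (1 - ((s : ℝ) - ⌊s⌋₊)) * K₂ ^ ((s : ℝ) - ⌊s⌋₊), by positivity, fun M N => ?_⟩
  have hM := toEuclideanLin_injective M
  have hN := toEuclideanLin_injective N
  have hMN := toEuclideanLin_injective (M * N)
  have a₁ := h₁ _ _ hM hN
  have a₂ := h₂ _ _ hM hN
  rw [← Matrix.toLpLin_mul_same, ← Units.val_mul] at a₁ a₂
  have θ0 : 0 ≤ (s : ℝ) - ⌊s⌋₊ := sub_nonneg.2 (floor_le_coe s)
  have θ1 : 0 ≤ 1 - ((s : ℝ) - ⌊s⌋₊) := by linarith [coe_le_floor_add_one s]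
  have p1 := singularProd_pos hM hs.le
  have p2 := singularProd_pos hM (Nat.succ_le_of_lt hs)
  have p3 := singularProd_pos hN hs.le
  have p4 := singularProd_pos hN (Nat.succ_le_of_lt hs)
  have p5 := singularProd_pos hMN hs.le
  have p6 := singularProd_pos hMN (Nat.succ_le_of_lt hs)
  rw [svf_eq_rpow hs, svf_eq_rpow hs, svf_eq_rpow hs]
  refine (mul_le_mul (Real.rpow_le_rpow p5.le a₁ θ1) (Real.rpow_le_rpow p6.le a₂ θ0)
    (by positivity) (by positivity)).trans (le_of_eq ?_)
  rw [Real.mul_rpow hK₁.le (by positivity), Real.mul_rpow hK₂.le (by positivity),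
    Real.mul_rpow p1.le p3.le, Real.mul_rpow p2.le p4.le]
  ring

/-- Interpolating the volume bounds between the two integers around `t` gives a bound in terms of
the singular value function. -/
theorem volume_ball_inter_preimage_le_svf {t : ℝ≥0} (ht : ⌊t⌋₊ < d) (M : GL (Fin d) ℝ)
    {R r : ℝ} (hR : 1 ≤ R) (hr : 0 < r) :
    volume {u : EuclideanSpace ℝ (Fin d) |
        ‖u‖ ≤ R ∧ ‖Matrix.toEuclideanLin (M : Matrix (Fin d) (Fin d) ℝ) u‖ ≤ r} ≤
      ENNReal.ofReal ((2 * R) ^ d * (r ^ (t : ℝ) / svf t (M : Matrix (Fin d) (Fin d) ℝ))) := by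
  have hM := toEuclideanLin_injective M
  have b₁ := volume_ball_inter_preimage_le hM ht.le hR hr.le
  have b₂ := volume_ball_inter_preimage_le hM (Nat.succ_le_of_lt ht) hR hr.le
  have p1 := singularProd_pos hM ht.le
  have p2 := singularProd_pos hM (Nat.succ_le_of_lt ht)
  have θ0 : 0 ≤ (t : ℝ) - ⌊t⌋₊ := sub_nonneg.2 (floor_le_coe t)
  have θ1 : 0 ≤ 1 - ((t : ℝ) - ⌊t⌋₊) := by linarith [coe_le_floor_add_one t]
  have hfin := ne_top_of_le_ne_top ENNReal.ofReal_ne_top b₁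
  set x := volume {u : EuclideanSpace ℝ (Fin d) |
        ‖u‖ ≤ R ∧ ‖Matrix.toEuclideanLin (M : Matrix (Fin d) (Fin d) ℝ) u‖ ≤ r}
  have hR0 : 0 < (2 * R) ^ d := by positivity
  rw [← ENNReal.ofReal_toReal hfin] at b₁ b₂ ⊢
  rw [ENNReal.ofReal_le_ofReal_iff (by positivity)] at b₁ b₂
  refine ENNReal.ofReal_le_ofReal ?_
  have hx : 0 ≤ x.toReal := ENNReal.toReal_nonneg
  have e1 : x.toReal = x.toReal ^ (1 - ((t : ℝ) - ⌊t⌋₊)) * x.toReal ^ ((t : ℝ) - ⌊t⌋₊) := by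
    rw [← Real.rpow_add_of_nonneg hx θ1 θ0]; simp
  have e2 : (2 * R) ^ d * (r ^ (t : ℝ) / svf t (M : Matrix (Fin d) (Fin d) ℝ)) =
      ((2 * R) ^ d * (r ^ ⌊t⌋₊ / singularProd
        (Matrix.toEuclideanLin (M : Matrix (Fin d) (Fin d) ℝ)) ⌊t⌋₊)) ^ (1 - ((t : ℝ) - ⌊t⌋₊)) *
      ((2 * R) ^ d * (r ^ (⌊t⌋₊ + 1) / singularProd
        (Matrix.toEuclideanLin (M : Matrix (Fin d) (Fin d) ℝ)) (⌊t⌋₊ + 1))) ^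
          ((t : ℝ) - ⌊t⌋₊) := by
    rw [Real.mul_rpow hR0.le (by positivity), Real.mul_rpow hR0.le (by positivity),
      mul_mul_mul_comm, ← Real.rpow_add hR0, Real.div_rpow (by positivity) p1.le,
      Real.div_rpow (by positivity) p2.le, div_mul_div_comm, ← svf_eq_rpow ht,
      ← Real.rpow_natCast r, ← Real.rpow_natCast r, ← Real.rpow_mul hr.le, ← Real.rpow_mul hr.le,
      ← Real.rpow_add hr, sub_add_cancel, Real.rpow_one]
    congr 3
    push_cast
    ring
  rw [e1, e2]
  exact mul_le_mul (Real.rpow_le_rpow hx b₁ θ1) (Real.rpow_le_rpow hx b₂ θ0) (by positivity)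
    (by positivity)

/-- With equal integer parts the two functions differ only by the power `s - t` of a single singular
value. For words this gain is exponential in the length, which later makes the energy sum geometric.
-/
theorem svf_le_rpow_mul_svf {s t : ℝ≥0} (hs : ⌊s⌋₊ < d) (hst : ⌊t⌋₊ = ⌊s⌋₊) (hts : t ≤ s)
    (M : GL (Fin d) ℝ) {a : ℝ}
    (ha : ∀ u, ‖Matrix.toEuclideanLin (M : Matrix (Fin d) (Fin d) ℝ) u‖ ≤ a * ‖u‖) :
    svf s (M : Matrix (Fin d) (Fin d) ℝ) ≤
      a ^ ((s : ℝ) - t) * svf t (M : Matrix (Fin d) (Fin d) ℝ) := by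
  have hM := toEuclideanLin_injective M
  have p1 := singularProd_pos hM hs.le
  have p2 := singularValues_pos hM hs
  have hts' : 0 ≤ (s : ℝ) - t := sub_nonneg.2 hts
  rw [svf_eq hs, svf_eq (hst ▸ hs), hst,
    show (s : ℝ) - ⌊s⌋₊ = ((s : ℝ) - t) + (t - ⌊s⌋₊) by ring, Real.rpow_add p2]
  have := Real.rpow_le_rpow p2.le (singularValues_le_of_norm_le ha hs) hts'
  calc _ = (Matrix.toEuclideanLin (M : Matrix (Fin d) (Fin d) ℝ)).singularValues ⌊s⌋₊ ^
          ((s : ℝ) - t) * (singularProd (Matrix.toEuclideanLin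
          (M : Matrix (Fin d) (Fin d) ℝ)) ⌊s⌋₊ * (Matrix.toEuclideanLin
          (M : Matrix (Fin d) (Fin d) ℝ)).singularValues ⌊s⌋₊ ^ ((t : ℝ) - ⌊s⌋₊)) := by ring
    _ ≤ _ := mul_le_mul_of_nonneg_right this (by positivity)

theorem svf_le_rpow {s : ℝ≥0} (hs : ⌊s⌋₊ < d) (M : GL (Fin d) ℝ) {a : ℝ}
    (ha : ∀ u, ‖Matrix.toEuclideanLin (M : Matrix (Fin d) (Fin d) ℝ) u‖ ≤ a * ‖u‖) :
    svf s (M : Matrix (Fin d) (Fin d) ℝ) ≤ a ^ (s : ℝ) := by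
  have hM := toEuclideanLin_injective M
  have p2 := singularValues_pos hM hs
  have ha0 : 0 < a := p2.trans_le (singularValues_le_of_norm_le ha hs)
  have h1 : singularProd (Matrix.toEuclideanLin (M : Matrix (Fin d) (Fin d) ℝ)) ⌊s⌋₊ ≤
      a ^ ⌊s⌋₊ := by
    calc _ ≤ ∏ _k ∈ Finset.range ⌊s⌋₊, a := Finset.prod_le_prod
          (fun _ _ => LinearMap.singularValues_nonneg _ _)
          fun k hk => singularValues_le_of_norm_le ha ((Finset.mem_range.1 hk).trans hs)
      _ = _ := by simp
  rw [svf_eq hs, show a ^ (s : ℝ) = a ^ ⌊s⌋₊ * a ^ ((s : ℝ) - ⌊s⌋₊) by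
    rw [← Real.rpow_natCast, ← Real.rpow_add ha0]; congr 1; ring]
  exact mul_le_mul h1 (Real.rpow_le_rpow p2.le (singularValues_le_of_norm_le ha hs)
    (sub_nonneg.2 (floor_le_coe s))) (by positivity) (by positivity)

end SingularValueFunction

/-! ### Covers by cylinders and level sums -/

section Content

variable {J : Type*} [Fintype J]

/-- The least total weight of a cover of the cylinder of `w` by cylinders of words that are at most
`n` letters longer than `w`. -/
def contentUpTo (c : List J → ℝ≥0∞) : ℕ → List J → ℝ≥0∞
  | 0, w => c w
  | n + 1, w => min (c w) (∑ i, contentUpTo c n (w ++ [i]))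

/-- The infimum of the total weights of finite covers of the cylinder of `w` by cylinders. -/
def content (c : List J → ℝ≥0∞) (w : List J) : ℝ≥0∞ :=
  ⨅ n, contentUpTo c n w

/-- The total weight of the words that extend `w` by `n` letters. -/
def levelSum (c : List J → ℝ≥0∞) : ℕ → List J → ℝ≥0∞
  | 0, w => c w
  | n + 1, w => ∑ i, levelSum c n (w ++ [i])

variable (c : List J → ℝ≥0∞)

theorem levelSum_eq_sum (n : ℕ) (w : List J) :
    levelSum c n w = ∑ u : Fin n → J, c (w ++ List.ofFn u) := by
  induction n generalizing w with
  | zero => simp [levelSum]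
  | succ n ih =>
    rw [levelSum, ← (Fin.consEquiv fun _ : Fin (n + 1) => J).sum_comp, Fintype.sum_prod_type]
    refine Finset.sum_congr rfl fun i _ => ?_
    rw [ih]
    refine Finset.sum_congr rfl fun u _ => ?_
    simp [Fin.consEquiv, List.ofFn_succ]

theorem contentUpTo_antitone (w : List J) : Antitone fun n => contentUpTo c n w := by
  refine antitone_nat_of_succ_le fun n => ?_
  induction n generalizing w with
  | zero => exact min_le_left _ _
  | succ n ih => exact min_le_min le_rfl (Finset.sum_le_sum fun i _ => ih (w ++ [i]))

theorem content_le (w : List J) : content c w ≤ c w := iInf_le _ 0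

/-- Covers of the children combine to a cover of `w`. The infimum over the depth passes through the
finite sum because it is a monotone limit. -/
theorem content_le_sum (w : List J) : content c w ≤ ∑ i, content c (w ++ [i]) := by
  have h : Tendsto (fun n => ∑ i, contentUpTo c n (w ++ [i])) atTop
      (𝓝 (∑ i, content c (w ++ [i]))) :=
    tendsto_finsetSum _ fun i _ => tendsto_atTop_iInf (contentUpTo_antitone c (w ++ [i]))
  exact ge_of_tendsto' h fun n => (iInf_le _ (n + 1)).trans (min_le_right _ _)

variable {c}

theorem levelSum_le_mul {K : ℝ≥0∞} (hc : ∀ u v, c (u ++ v) ≤ K * (c u * c v)) (n : ℕ)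
    (w : List J) : levelSum c n w ≤ K * (c w * levelSum c n []) := by
  rw [levelSum_eq_sum, levelSum_eq_sum, Finset.mul_sum, Finset.mul_sum]
  exact Finset.sum_le_sum fun u _ => by simpa using hc w (List.ofFn u)

theorem levelSum_ne_top (hfin : ∀ w, c w ≠ ∞) (n : ℕ) (w : List J) : levelSum c n w ≠ ∞ := by
  rw [levelSum_eq_sum]
  exact ENNReal.sum_ne_top.2 fun u _ => hfin _

/-- If the words of length at most `n + 1` contain a cover of small total weight, then the level
sums decay exponentially. -/
theorem exists_levelSum_le_pow {K : ℝ≥0∞} (hc : ∀ u v, c (u ++ v) ≤ K * (c u * c v))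
    (hfin : ∀ w, c w ≠ ∞) {n : ℕ} (hn : K * (∑ i, contentUpTo c n [i]) * 2 ≤ 1) :
    ∃ (C : ℝ≥0∞) (ρ : ℝ≥0), C ≠ ∞ ∧ ρ < 1 ∧ ∀ N, levelSum c N [] ≤ C * (ρ : ℝ≥0∞) ^ N := by
  -- With `1 - ρ = 1 / (2(n+1))`, Bernoulli's inequality gives `ρ^(n+1) ≥ 1/2`.
  obtain ⟨ρ, hρ1, hρ⟩ : ∃ ρ : ℝ≥0, ρ < 1 ∧ (1 : ℝ≥0∞) ≤ 2 * (ρ : ℝ≥0∞) ^ (n + 1) := by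
    have hn0 : (0 : ℝ) < n + 1 := by positivity
    have h0 : (0 : ℝ) ≤ 1 - 1 / (2 * (n + 1)) := by
      rw [sub_nonneg, div_le_one (by positivity)]; linarith
    have hpos : 0 < 1 / (2 * ((n : ℝ) + 1)) := by positivity
    refine ⟨Real.toNNReal (1 - 1 / (2 * (n + 1))), ?_, ?_⟩
    · rw [Real.toNNReal_lt_one]
      linarith
    · have h1 := one_add_mul_le_pow (a := -(1 / (2 * ((n : ℝ) + 1)))) (by linarith) (n + 1)
      have h2 : 1 + ((n + 1 : ℕ) : ℝ) * -(1 / (2 * ((n : ℝ) + 1))) = 1 / 2 := by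
        push_cast; field_simp; norm_num
      rw [h2, ← sub_eq_add_neg] at h1
      have h3 : (1 : ℝ≥0) ≤ 2 * Real.toNNReal (1 - 1 / (2 * ((n : ℝ) + 1))) ^ (n + 1) := by
        rw [← NNReal.coe_le_coe, NNReal.coe_mul, NNReal.coe_pow, Real.coe_toNNReal _ h0]
        push_cast
        linarith
      exact_mod_cast h3
  have hρ1' : (ρ : ℝ≥0∞) ≤ 1 := by exact_mod_cast hρ1.le
  -- `S` takes care of the levels up to `n`; beyond these, strong induction applies.
  set S := ∑ M ∈ Finset.range (n + 1), levelSum c M [] with hS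
  refine ⟨2 * S, ρ, ENNReal.mul_ne_top ENNReal.ofNat_ne_top
    (ENNReal.sum_ne_top.2 fun M _ => levelSum_ne_top hfin M []), hρ1, fun N => ?_⟩
  induction N using Nat.strong_induction_on with
  | _ N ih =>
  rcases lt_or_ge N (n + 1) with hN | hN
  · calc levelSum c N [] ≤ S :=
          Finset.single_le_sum (f := fun M => levelSum c M []) (fun _ _ => zero_le)
            (Finset.mem_range.2 hN)
      _ = S * 1 := (mul_one _).symm
      _ ≤ S * (2 * (ρ : ℝ≥0∞) ^ (n + 1)) := by gcongr
      _ ≤ S * (2 * (ρ : ℝ≥0∞) ^ N) := by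
          gcongr S * (2 * ?_)
          exact pow_le_pow_right_of_le_one' hρ1' hN.le
      _ = _ := by ring
  · set D := K * (2 * S * (ρ : ℝ≥0∞) ^ (N - (n + 1))) with hD
    -- A nonempty `w` of length at most `n + 1` leaves fewer than `N` and at least `N - (n+1)`
    -- letters, so the induction hypothesis bounds the remaining level sum.
    have base : ∀ M (w : List J), w ≠ [] → M + w.length = N → w.length ≤ n + 1 →
        levelSum c M w ≤ D * c w := by
      intro M w hw hM hl
      have hl0 : 0 < w.length := List.length_pos_iff.2 hw
      calc levelSum c M w ≤ K * (c w * levelSum c M []) := levelSum_le_mul hc M w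
        _ ≤ K * (c w * (2 * S * (ρ : ℝ≥0∞) ^ M)) := by gcongr; exact ih M (by omega)
        _ ≤ K * (c w * (2 * S * (ρ : ℝ≥0∞) ^ (N - (n + 1)))) := by
            gcongr K * (c w * (2 * S * ?_))
            exact pow_le_pow_right_of_le_one' hρ1' (by omega)
        _ = D * c w := by rw [hD]; ring
    -- Regrouping the words of length `N` by the elements of the cheapest cover replaces `c w` by
    -- the content.
    have step : ∀ j M (w : List J), w ≠ [] → M + w.length = N → j + w.length ≤ n + 1 →
        levelSum c M w ≤ D * contentUpTo c j w := by
      intro j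
      induction j with
      | zero => intro M w hw hM hl; exact base M w hw hM (by omega)
      | succ j ihj =>
        intro M w hw hM hl
        rw [contentUpTo, mul_min]
        refine le_min (base M w hw hM (by omega)) ?_
        obtain ⟨M, rfl⟩ : ∃ M', M = M' + 1 := ⟨M - 1, by omega⟩
        rw [levelSum, Finset.mul_sum]
        refine Finset.sum_le_sum fun i _ => ihj M (w ++ [i]) (by simp) ?_ ?_
        · simp only [List.length_append, List.length_singleton]; omega
        · simp only [List.length_append, List.length_singleton]; omega
    obtain ⟨N, rfl⟩ : ∃ N', N = N' + 1 := ⟨N - 1, by omega⟩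
    calc levelSum c (N + 1) [] = ∑ i, levelSum c N [i] := rfl
      _ ≤ ∑ i, D * contentUpTo c n [i] :=
          Finset.sum_le_sum fun i _ => step n N [i] (by simp) rfl (by simp)
      _ = (K * ∑ i, contentUpTo c n [i]) * (2 * S * (ρ : ℝ≥0∞) ^ (N + 1 - (n + 1))) := by
          rw [← Finset.mul_sum, hD]; ring
      -- The inserted factor restores the exponent `N + 1`; its `2` is absorbed by `hn`.
      _ ≤ (K * ∑ i, contentUpTo c n [i]) * (2 * S * (ρ : ℝ≥0∞) ^ (N + 1 - (n + 1))) *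
            (2 * (ρ : ℝ≥0∞) ^ (n + 1)) := le_mul_of_one_le_right zero_le hρ
      _ = (K * (∑ i, contentUpTo c n [i]) * 2) *
            (2 * S * ((ρ : ℝ≥0∞) ^ (N + 1 - (n + 1)) * (ρ : ℝ≥0∞) ^ (n + 1))) := by ring
      _ ≤ 1 * (2 * S * ((ρ : ℝ≥0∞) ^ (N + 1 - (n + 1)) * (ρ : ℝ≥0∞) ^ (n + 1))) := by gcongr
      _ = 2 * S * (ρ : ℝ≥0∞) ^ (N + 1) := by
          rw [one_mul, ← pow_add, Nat.sub_add_cancel hN]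

end Content

/-! ### Nonnegative pressure gives positive content -/

section Pressure

variable {d : ℕ} {J : Type*}

/-- The weight `φ^s(A_{i_1} ⋯ A_{i_n})` of the word `(i_1, …, i_n)`. -/
def svfWeight (A : J → GL (Fin d) ℝ) (s : ℝ≥0) (w : List J) : ℝ≥0∞ :=
  ENNReal.ofReal (svf s ((w.map A).prod : Matrix (Fin d) (Fin d) ℝ))

theorem svfSum_eq_levelSum [Fintype J] (A : J → GL (Fin d) ℝ) (s : ℝ≥0) (n : ℕ) :
    svfSum A s n = levelSum (svfWeight A s) n [] := by
  rw [svfSum, tsum_fintype, levelSum_eq_sum]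
  refine Finset.sum_congr rfl fun u _ => ?_
  rw [svfWeight, wordProd, List.nil_append, List.map_ofFn]
  rfl

theorem pressure_neg_of_le [Fintype J] {A : J → GL (Fin d) ℝ} {s : ℝ≥0} {C : ℝ≥0∞} {ρ : ℝ≥0}
    (hC : C ≠ ∞) (hρ : ρ < 1) (h : ∀ N, svfSum A s N ≤ C * (ρ : ℝ≥0∞) ^ N) : pressure A s < 0 := by
  -- A rate strictly between `ρ` and `1` absorbs the constant, as `C (ρ / q)^N ≤ 1` eventually.
  obtain ⟨q, hρq, hq⟩ := exists_between hρ
  have hq0 : 0 < q := zero_le.trans_lt hρq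
  have hlog : ENNReal.log (q : ℝ≥0∞) < 0 := by
    rw [ENNReal.log_lt_zero_iff]; exact_mod_cast hq
  refine lt_of_le_of_lt ?_ hlog
  have hlim : Tendsto (fun N : ℕ => C * ((ρ / q : ℝ≥0) : ℝ≥0∞) ^ N) atTop (𝓝 (C * 0)) :=
    ENNReal.Tendsto.const_mul (ENNReal.tendsto_pow_atTop_nhds_zero_of_lt_one (by
      exact_mod_cast (div_lt_one hq0).2 hρq)) (Or.inr hC)
  rw [mul_zero] at hlim
  refine limsup_le_of_le (by isBoundedDefault) ?_
  filter_upwards [hlim.eventually (ge_mem_nhds zero_lt_one), eventually_gt_atTop 0] with N hN hN0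
  have h1 : svfSum A s N ≤ (q : ℝ≥0∞) ^ N := by
    calc svfSum A s N ≤ C * (ρ : ℝ≥0∞) ^ N := h N
      _ = C * ((ρ / q : ℝ≥0) : ℝ≥0∞) ^ N * (q : ℝ≥0∞) ^ N := by
        rw [mul_assoc, ← mul_pow, ← ENNReal.coe_mul, div_mul_cancel₀ _ hq0.ne']
      _ ≤ 1 * (q : ℝ≥0∞) ^ N := by gcongr
      _ = _ := one_mul _
  rw [EReal.div_le_iff_le_mul (by exact_mod_cast hN0) (EReal.natCast_ne_top N)]
  exact (ENNReal.log_monotone h1).trans_eq (by rw [ENNReal.log_pow, mul_comm])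

theorem svfWeight_append_le {s : ℝ≥0} (hs : ⌊s⌋₊ < d) :
    ∃ K : ℝ≥0∞, K ≠ 0 ∧ K ≠ ∞ ∧ ∀ (A : J → GL (Fin d) ℝ) (u v : List J),
      svfWeight A s (u ++ v) ≤ K * (svfWeight A s u * svfWeight A s v) := by
  obtain ⟨K, hK, h⟩ := exists_svf_mul_le hs
  refine ⟨ENNReal.ofReal K, by simpa using hK, ENNReal.ofReal_ne_top, fun A u v => ?_⟩
  rw [svfWeight, svfWeight, svfWeight, ← ENNReal.ofReal_mul (svf_pos hs _).le,
    ← ENNReal.ofReal_mul hK.le, List.map_append, List.prod_append]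
  exact ENNReal.ofReal_le_ofReal (h _ _)

theorem svfWeight_ne_zero {s : ℝ≥0} (hs : ⌊s⌋₊ < d) (A : J → GL (Fin d) ℝ) (w : List J) :
    svfWeight A s w ≠ 0 := by
  simpa [svfWeight] using svf_pos hs (w.map A).prod

theorem svfWeight_ne_top (s : ℝ≥0) (A : J → GL (Fin d) ℝ) (w : List J) :
    svfWeight A s w ≠ ∞ := ENNReal.ofReal_ne_top

theorem content_svfWeight_ne_zero [Fintype J] {s : ℝ≥0} (hs : ⌊s⌋₊ < d) {A : J → GL (Fin d) ℝ}
    (hP : ¬ pressure A s < 0) : content (svfWeight A s) [] ≠ 0 := by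
  obtain ⟨K, hK0, hKt, hK⟩ := svfWeight_append_le (J := J) hs
  -- Below this threshold `exists_levelSum_le_pow` would make the pressure negative.
  have key : ∀ n, (K * 2)⁻¹ ≤ ∑ i, contentUpTo (svfWeight A s) n [i] := by
    intro n
    by_contra hcon
    refine hP ?_
    have : K * (∑ i, contentUpTo (svfWeight A s) n [i]) * 2 ≤ 1 := by
      calc _ = (K * 2) * ∑ i, contentUpTo (svfWeight A s) n [i] := by ring
        _ ≤ (K * 2) * (K * 2)⁻¹ := by gcongr; exact (not_le.1 hcon).le
        _ ≤ 1 := ENNReal.mul_inv_le_one _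
    obtain ⟨C, ρ, hC, hρ, h⟩ := exists_levelSum_le_pow (hK A) (svfWeight_ne_top s A) this
    exact pressure_neg_of_le hC hρ fun N => by rw [svfSum_eq_levelSum]; exact h N
  have hmin : min (svfWeight A s []) (K * 2)⁻¹ ≤ content (svfWeight A s) [] := by
    refine le_iInf fun n => ?_
    cases n with
    | zero => exact min_le_left _ _
    | succ n => exact min_le_min le_rfl (key n)
  refine (lt_of_lt_of_le ?_ hmin).ne'
  refine lt_min (pos_iff_ne_zero.2 (svfWeight_ne_zero hs A _)) ?_
  rw [ENNReal.inv_pos]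
  exact ENNReal.mul_ne_top hKt ENNReal.ofNat_ne_top

end Pressure

/-! ### Frostman measures on the sequence space -/

section Frostman

open ProbabilityTheory

variable {J : Type*}

/-- The first `n` letters of the sequence `x`. -/
def initialWord {J : Type*} (x : ℕ → J) (n : ℕ) : List J := (List.range n).map x

theorem initialWord_succ (x : ℕ → J) (n : ℕ) :
    initialWord x (n + 1) = initialWord x n ++ [x n] := by
  simp [initialWord, List.range_succ]

theorem length_initialWord (x : ℕ → J) (n : ℕ) : (initialWord x n).length = n := by
  simp [initialWord]

theorem measurableSet_initialWord_eq [Countable J] [MeasurableSpace J] [DiscreteMeasurableSpace J]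
    (n : ℕ) (w : List J) : MeasurableSet {x : ℕ → J | initialWord x n = w} := by
  induction n generalizing w with
  | zero => simp [initialWord]
  | succ n ih =>
    have : {x : ℕ → J | initialWord x (n + 1) = w} =
        ⋃ i : J, {x | initialWord x n ++ [i] = w} ∩ (fun x => x n) ⁻¹' {i} := by
      ext x; simp [initialWord_succ]
    rw [this]
    refine MeasurableSet.iUnion fun i =>
      MeasurableSet.inter ?_ (measurable_pi_apply n (MeasurableSet.of_discrete))
    rcases List.eq_nil_or_concat w with rfl | ⟨w', j, rfl⟩
    · simp
    · by_cases hij : i = j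
      · subst hij
        simpa using ih w'
      · simp [hij]

/-- A set function on words that is subadditive over the children of each word dominates, up to a
constant, the cylinder masses of a probability measure. -/
theorem exists_measure_mul_le [Fintype J] [Nonempty J] [MeasurableSpace J]
    [DiscreteMeasurableSpace J] {m : List J → ℝ≥0∞} (hm : ∀ w, m w ≤ ∑ i, m (w ++ [i]))
    (hfin : ∀ w, m w ≠ ∞) :
    ∃ μ : Measure (ℕ → J), IsProbabilityMeasure μ ∧
      ∀ n w, w.length = n → m [] * μ {x | initialWord x n = w} ≤ m w := by
  classical
  have hsum : ∀ w, ∑' i, m (w ++ [i]) ≠ ∞ := fun w => by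
    rw [tsum_fintype]; exact ENNReal.sum_ne_top.2 fun i _ => hfin _
  -- The mass of `w` is passed to its children in proportion to `m`. If all children have value `0`,
  -- then so does `w`, and the choice is immaterial.
  let p : List J → PMF J := fun w =>
    if h : ∑' i, m (w ++ [i]) ≠ 0 then PMF.normalize (fun i => m (w ++ [i])) h (hsum w)
    else PMF.pure (Classical.arbitrary J)
  have hp : ∀ w i, m w * p w i ≤ m (w ++ [i]) := by
    intro w i
    by_cases h : ∑' i, m (w ++ [i]) ≠ 0
    · simp only [p, dif_pos h, PMF.normalize_apply]
      calc m w * (m (w ++ [i]) * (∑' i, m (w ++ [i]))⁻¹)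
          = m (w ++ [i]) * (m w * (∑' i, m (w ++ [i]))⁻¹) := by ring
        _ ≤ m (w ++ [i]) * 1 := by
          gcongr
          rw [← div_eq_mul_inv]
          exact ENNReal.div_le_of_le_mul (by rw [one_mul, tsum_fintype]; exact hm w)
        _ = _ := mul_one _
    · rw [not_not, tsum_fintype] at h
      have : m w = 0 := le_antisymm ((hm w).trans h.le) zero_le
      simp [this]
  -- The trajectory measure starts at coordinate `0`, which is a dummy with Dirac law. The letters
  -- are the coordinates `1, …, n`, and the shift by one at the end discards the dummy.
  let word : ∀ n, (Finset.Iic n → J) → List J := fun n x =>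
    (List.range n).map fun k =>
      if h : k + 1 ∈ Finset.Iic n then x ⟨k + 1, h⟩ else Classical.arbitrary J
  have hword : ∀ n (x : ℕ → J),
      word n (Preorder.frestrictLe n x) = initialWord (fun k => x (k + 1)) n := by
    intro n x
    refine List.map_congr_left fun k hk => ?_
    have : k + 1 ∈ Finset.Iic n := Finset.mem_Iic.2 (List.mem_range.1 hk)
    simp [List.mem_range.1 hk]
  let κ : ∀ n : ℕ, Kernel (Finset.Iic n → J) J := fun n =>
    { toFun := fun x => (p (word n x)).toMeasure
      measurable' := .of_discrete }
  have hκ : ∀ n x, κ n x = (p (word n x)).toMeasure := fun _ _ => rfl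
  have : ∀ n, IsMarkovKernel (κ n) := fun n => ⟨fun x => by rw [hκ]; infer_instance⟩
  let ν : Measure (ℕ → J) :=
    Kernel.trajMeasure (X := fun _ => J) (Measure.dirac (Classical.arbitrary J)) κ
  have hshift : Measurable fun (x : ℕ → J) (k : ℕ) => x (k + 1) :=
    measurable_pi_lambda _ fun k => measurable_pi_apply (k + 1)
  have hνp : IsProbabilityMeasure ν := by
    simp only [ν]; infer_instance
  refine ⟨ν.map fun x k => x (k + 1), Measure.isProbabilityMeasure_map hshift.aemeasurable, ?_⟩
  have hstep : ∀ n (w : List J) (i : J),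
      ν {x | initialWord (fun k => x (k + 1)) (n + 1) = w ++ [i]} =
        p w i * ν {x | initialWord (fun k => x (k + 1)) n = w} := by
    intro n w i
    have h := Kernel.map_frestrictLe_trajMeasure_compProd_eq_map_trajMeasure (X := fun _ => J)
      (κ := κ) (μ₀ := Measure.dirac (Classical.arbitrary J)) (a := n)
    have h2 := DFunLike.congr_fun h ({x | word n x = w} ×ˢ {i})
    rw [Measure.compProd_apply_prod .of_discrete .of_discrete,
      Measure.map_apply (by fun_prop) (MeasurableSet.of_discrete.prod .of_discrete)] at h2
    have e1 : (fun x : ℕ → J => (Preorder.frestrictLe (π := fun _ => J) n x, x (n + 1))) ⁻¹'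
        ({x | word n x = w} ×ˢ {i}) =
        {x | initialWord (fun k => x (k + 1)) (n + 1) = w ++ [i]} := by
      ext x
      simp [initialWord_succ, hword]
    rw [e1] at h2
    refine h2.symm.trans ?_
    rw [setLIntegral_congr_fun (g := fun _ => p w i) .of_discrete, setLIntegral_const,
      Measure.map_apply (by fun_prop) .of_discrete]
    · congr 2
      ext x
      simp [hword]
    · intro x hx
      simp only [Set.mem_ofPred_eq] at hx
      simp only [hκ, hx]
      exact (p w).toMeasure_apply_singleton i .of_discrete
  intro n
  induction n with
  | zero =>
    intro w hw
    rw [List.length_eq_zero_iff.1 hw]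
    calc _ ≤ m [] * 1 := by
          gcongr
          have := Measure.isProbabilityMeasure_map (μ := ν) hshift.aemeasurable
          exact prob_le_one
      _ = _ := mul_one _
  | succ n ih =>
    intro w hw
    obtain ⟨w, i, rfl⟩ : ∃ w' i, w = w' ++ [i] := by
      rcases List.eq_nil_or_concat w with rfl | ⟨w', i, rfl⟩
      · simp at hw
      · exact ⟨w', i, by simp⟩
    have hl : w.length = n := by simpa using hw
    have ih' := ih w hl
    rw [Measure.map_apply hshift (measurableSet_initialWord_eq _ _)] at ih' ⊢
    calc m [] * ν {x | initialWord (fun k => x (k + 1)) (n + 1) = w ++ [i]}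
        = (m [] * ν {x | initialWord (fun k => x (k + 1)) n = w}) * p w i := by
          rw [hstep]; ring
      _ ≤ m w * p w i := by gcongr; exact ih'
      _ ≤ m (w ++ [i]) := hp w i

theorem exists_measure_le_svfWeight {d : ℕ} [Fintype J] [Nonempty J] [MeasurableSpace J]
    [DiscreteMeasurableSpace J] {s : ℝ≥0} (hs : ⌊s⌋₊ < d) {A : J → GL (Fin d) ℝ}
    (hP : ¬ pressure A s < 0) :
    ∃ (μ : Measure (ℕ → J)) (C : ℝ≥0∞), IsProbabilityMeasure μ ∧ C ≠ ∞ ∧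
      ∀ n w, w.length = n → μ {x | initialWord x n = w} ≤ C * svfWeight A s w := by
  obtain ⟨μ, hμ, h⟩ := exists_measure_mul_le (content_le_sum (svfWeight A s))
    fun w => ne_top_of_le_ne_top (svfWeight_ne_top s A w) (content_le _ w)
  have h0 := content_svfWeight_ne_zero hs hP
  have ht := ne_top_of_le_ne_top (svfWeight_ne_top s A []) (content_le _ [])
  refine ⟨μ, (content (svfWeight A s) [])⁻¹, hμ, ENNReal.inv_ne_top.2 h0, fun n w hw => ?_⟩
  rw [← ENNReal.mul_le_iff_le_inv h0 ht]
  exact (h n w hw).trans (content_le _ w)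

end Frostman

/-! ### The coding map -/

section Coding

variable {d : ℕ} {J : Type*}

/-- The linear part `A_{i_1} ⋯ A_{i_n}` of the composition along the word `(i_1, …, i_n)`. -/
def prodLin (A : J → GL (Fin d) ℝ) (w : List J) :
    EuclideanSpace ℝ (Fin d) →ₗ[ℝ] EuclideanSpace ℝ (Fin d) :=
  Matrix.toEuclideanLin ((w.map A).prod : Matrix (Fin d) (Fin d) ℝ)

/-- The point of the self-affine set with address `x`. -/
def codingMap (A : J → GL (Fin d) ℝ) (v : J → EuclideanSpace ℝ (Fin d)) (x : ℕ → J) :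
    EuclideanSpace ℝ (Fin d) :=
  ∑' k, prodLin A (initialWord x k) (v (x k))

variable {A : J → GL (Fin d) ℝ} {α : ℝ}

theorem prodLin_nil : prodLin A [] = LinearMap.id := by
  simp [prodLin]

theorem prodLin_append (w w' : List J) : prodLin A (w ++ w') = prodLin A w ∘ₗ prodLin A w' := by
  rw [prodLin, prodLin, prodLin, ← Matrix.toLpLin_mul_same, ← Units.val_mul, List.map_append,
    List.prod_append]

theorem prodLin_singleton (i : J) :
    prodLin A [i] = Matrix.toEuclideanLin (A i : Matrix (Fin d) (Fin d) ℝ) := by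
  simp [prodLin]

theorem norm_prodLin_le (hα0 : 0 ≤ α)
    (hα : ∀ i u, ‖Matrix.toEuclideanLin (A i : Matrix (Fin d) (Fin d) ℝ) u‖ ≤ α * ‖u‖)
    (w : List J) (u : EuclideanSpace ℝ (Fin d)) : ‖prodLin A w u‖ ≤ α ^ w.length * ‖u‖ := by
  induction w generalizing u with
  | nil => simp [prodLin_nil]
  | cons i w ih =>
    rw [← List.singleton_append, prodLin_append, prodLin_singleton, LinearMap.comp_apply]
    calc _ ≤ α * ‖prodLin A w u‖ := hα i _
      _ ≤ α * (α ^ w.length * ‖u‖) := by gcongr; exact ih u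
      _ = _ := by
        simp only [List.singleton_append, List.length_cons]; ring

theorem iterComp_affineMap_apply (v : J → EuclideanSpace ℝ (Fin d)) (x : ℕ → J) (n : ℕ)
    (y : EuclideanSpace ℝ (Fin d)) :
    iterComp (fun k => affineMap A v (x k)) n y = prodLin A (initialWord x n) y +
      ∑ k ∈ Finset.range n, prodLin A (initialWord x k) (v (x k)) := by
  induction n generalizing y with
  | zero => simp [iterComp, initialWord, prodLin_nil]
  | succ n ih =>
    rw [iterComp, Function.comp_apply, ih, affineMap, map_add, Finset.sum_range_succ,
      initialWord_succ, prodLin_append, prodLin_singleton, LinearMap.comp_apply]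
    abel

theorem norm_term_le (hα0 : 0 ≤ α)
    (hα : ∀ i u, ‖Matrix.toEuclideanLin (A i : Matrix (Fin d) (Fin d) ℝ) u‖ ≤ α * ‖u‖)
    {v : J → EuclideanSpace ℝ (Fin d)} {V : ℝ} (hV : ∀ i, ‖v i‖ ≤ V) (x : ℕ → J) (k : ℕ) :
    ‖prodLin A (initialWord x k) (v (x k))‖ ≤ α ^ k * V := by
  refine (norm_prodLin_le hα0 hα _ _).trans ?_
  rw [length_initialWord]
  gcongr
  exact hV _

theorem exists_forall_norm_le [Finite J] (v : J → EuclideanSpace ℝ (Fin d)) :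
    ∃ V, ∀ i, ‖v i‖ ≤ V := by
  obtain ⟨V, hV⟩ := (Set.finite_range fun i => ‖v i‖).bddAbove
  exact ⟨V, fun i => hV ⟨i, rfl⟩⟩

theorem summable_codingMap [Finite J] (hα0 : 0 ≤ α) (hα1 : α < 1)
    (hα : ∀ i u, ‖Matrix.toEuclideanLin (A i : Matrix (Fin d) (Fin d) ℝ) u‖ ≤ α * ‖u‖)
    (v : J → EuclideanSpace ℝ (Fin d)) (x : ℕ → J) :
    Summable fun k => prodLin A (initialWord x k) (v (x k)) := by
  obtain ⟨V, hV⟩ := exists_forall_norm_le v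
  exact Summable.of_norm_bounded ((summable_geometric_of_lt_one hα0 hα1).mul_right V)
    fun k => norm_term_le hα0 hα hV x k

theorem norm_codingMap_le (hα0 : 0 ≤ α) (hα1 : α < 1)
    (hα : ∀ i u, ‖Matrix.toEuclideanLin (A i : Matrix (Fin d) (Fin d) ℝ) u‖ ≤ α * ‖u‖)
    {v : J → EuclideanSpace ℝ (Fin d)} {V : ℝ} (hV : ∀ i, ‖v i‖ ≤ V) (x : ℕ → J) :
    ‖codingMap A v x‖ ≤ (1 - α)⁻¹ * V :=
  tsum_of_norm_bounded ((hasSum_geometric_of_lt_one hα0 hα1).mul_right V)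
    fun k => norm_term_le hα0 hα hV x k

theorem tendsto_iterComp_codingMap [Finite J] (hα0 : 0 ≤ α) (hα1 : α < 1)
    (hα : ∀ i u, ‖Matrix.toEuclideanLin (A i : Matrix (Fin d) (Fin d) ℝ) u‖ ≤ α * ‖u‖)
    (v : J → EuclideanSpace ℝ (Fin d)) (x : ℕ → J) (y : EuclideanSpace ℝ (Fin d)) :
    Tendsto (fun n => iterComp (fun k => affineMap A v (x k)) n y) atTop
      (𝓝 (codingMap A v x)) := by
  have h1 : Tendsto (fun n => prodLin A (initialWord x n) y) atTop (𝓝 0) := by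
    refine squeeze_zero_norm (a := fun n => α ^ n * ‖y‖) (fun n => ?_) ?_
    · simpa [length_initialWord] using norm_prodLin_le hα0 hα (initialWord x n) y
    · simpa using (tendsto_pow_atTop_nhds_zero_of_lt_one hα0 hα1).mul_const ‖y‖
  have h2 := (summable_codingMap hα0 hα1 hα v x).hasSum.tendsto_sum_nat
  simp only [iterComp_affineMap_apply]
  simpa [codingMap] using h1.add h2

theorem initialWord_add (x : ℕ → J) (n k : ℕ) :
    initialWord x (n + k) = initialWord x n ++ initialWord (fun j => x (n + j)) k := by
  simp [initialWord, List.range_add, Function.comp_def]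

theorem codingMap_eq_add [Finite J] (hα0 : 0 ≤ α) (hα1 : α < 1)
    (hα : ∀ i u, ‖Matrix.toEuclideanLin (A i : Matrix (Fin d) (Fin d) ℝ) u‖ ≤ α * ‖u‖)
    (v : J → EuclideanSpace ℝ (Fin d)) (x : ℕ → J) (n : ℕ) :
    codingMap A v x = ∑ k ∈ Finset.range n, prodLin A (initialWord x k) (v (x k)) +
      prodLin A (initialWord x n) (codingMap A v fun j => x (n + j)) := by
  rw [codingMap, ← (summable_codingMap hα0 hα1 hα v x).sum_add_tsum_nat_add n]
  congr 1
  have h := (summable_codingMap hα0 hα1 hα v fun j => x (n + j)).map_tsum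
    (LinearMap.toContinuousLinearMap (prodLin A (initialWord x n)))
    (LinearMap.toContinuousLinearMap (prodLin A (initialWord x n))).continuous
  simp only [LinearMap.coe_toContinuousLinearMap'] at h
  rw [codingMap, h]
  refine tsum_congr fun k => ?_
  rw [add_comm k n, initialWord_add, prodLin_append, LinearMap.comp_apply]

theorem initialWord_eq_of_forall {x y : ℕ → J} {n : ℕ} (h : ∀ k < n, x k = y k) :
    initialWord x n = initialWord y n :=
  List.map_congr_left fun k hk => h k (List.mem_range.1 hk)

theorem codingMap_sub_eq [Finite J] (hα0 : 0 ≤ α) (hα1 : α < 1)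
    (hα : ∀ i u, ‖Matrix.toEuclideanLin (A i : Matrix (Fin d) (Fin d) ℝ) u‖ ≤ α * ‖u‖)
    (v : J → EuclideanSpace ℝ (Fin d)) {x y : ℕ → J} {n : ℕ} (h : ∀ k < n, x k = y k) :
    codingMap A v x - codingMap A v y = prodLin A (initialWord x n)
      (codingMap A v (fun j => x (n + j)) - codingMap A v fun j => y (n + j)) := by
  rw [codingMap_eq_add hα0 hα1 hα v x n, codingMap_eq_add hα0 hα1 hα v y n, map_sub,
    initialWord_eq_of_forall h]
  have : ∑ k ∈ Finset.range n, prodLin A (initialWord x k) (v (x k)) =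
      ∑ k ∈ Finset.range n, prodLin A (initialWord y k) (v (y k)) := by
    refine Finset.sum_congr rfl fun k hk => ?_
    have hk := Finset.mem_range.1 hk
    rw [h k hk, initialWord_eq_of_forall fun j hj => h j (hj.trans hk)]
  rw [this]
  abel

theorem measurable_codingMap [Finite J] [MeasurableSpace J] [DiscreteMeasurableSpace J]
    (hα0 : 0 ≤ α) (hα1 : α < 1)
    (hα : ∀ i u, ‖Matrix.toEuclideanLin (A i : Matrix (Fin d) (Fin d) ℝ) u‖ ≤ α * ‖u‖) :
    Measurable fun p : (J → EuclideanSpace ℝ (Fin d)) × (ℕ → J) => codingMap A p.1 p.2 := by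
  have hterm : ∀ k, Measurable fun p : (J → EuclideanSpace ℝ (Fin d)) × (ℕ → J) =>
      prodLin A (initialWord p.2 k) (p.1 (p.2 k)) := by
    intro k
    -- Words form a countable set, so with the discrete `σ`-algebra measurability can be checked for
    -- one word and one letter at a time.
    let : MeasurableSpace (List J) := ⊤
    have hw : Measurable fun x : ℕ → J => initialWord x k :=
      measurable_to_countable' fun w => measurableSet_initialWord_eq k w
    have hF : Measurable fun q : (J → EuclideanSpace ℝ (Fin d)) × (List J × J) =>
        prodLin A q.2.1 (q.1 q.2.2) := by
      refine measurable_from_prod_countable_left fun q => ?_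
      have h1 : Measurable (prodLin A q.1) :=
        (LinearMap.continuous_of_finiteDimensional (prodLin A q.1)).measurable
      have h2 : Measurable fun v : J → EuclideanSpace ℝ (Fin d) => v q.2 := measurable_pi_apply q.2
      exact h1.comp h2
    have hk : Measurable fun x : ℕ → J => x k := measurable_pi_apply k
    have hG : Measurable fun p : (J → EuclideanSpace ℝ (Fin d)) × (ℕ → J) =>
        (p.1, (initialWord p.2 k, p.2 k)) :=
      measurable_fst.prodMk ((hw.comp measurable_snd).prodMk (hk.comp measurable_snd))
    have := hF.comp hG
    simpa only [Function.comp_def] using this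
  refine measurable_of_tendsto_metrizable
    (f := fun n (p : (J → EuclideanSpace ℝ (Fin d)) × (ℕ → J)) =>
      ∑ k ∈ Finset.range n, prodLin A (initialWord p.2 k) (p.1 (p.2 k)))
    (fun n => Finset.measurable_fun_sum _ fun k _ => hterm k) ?_
  rw [tendsto_pi_nhds]
  exact fun p => (summable_codingMap hα0 hα1 hα p.1 p.2).hasSum.tendsto_sum_nat

end Coding

/-! ### Expanding dependence on a translation vector -/

section Transversality

variable {d : ℕ} {J : Type*} [DecidableEq J] {A : J → GL (Fin d) ℝ} {α : ℝ}

/-- Total weight `∑ α ^ k` of the positions `k ≥ 1` at which `x` or `y` has the letter `l`. -/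
def letterWeight (α : ℝ) (x y : ℕ → J) (l : J) : ℝ :=
  ∑' k : ℕ, α ^ (k + 1) *
    ((if x (k + 1) = l then 1 else 0) + (if y (k + 1) = l then 1 else 0))

theorem summable_letterWeight (hα0 : 0 ≤ α) (hα1 : α < 1) (x y : ℕ → J) (l : J) :
    Summable fun k : ℕ => α ^ (k + 1) *
      ((if x (k + 1) = l then (1 : ℝ) else 0) + (if y (k + 1) = l then 1 else 0)) := by
  refine Summable.of_nonneg_of_le (fun k => by positivity) (fun k => ?_)
    ((summable_geometric_of_lt_one hα0 hα1).mul_right 2)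
  refine mul_le_mul (pow_le_pow_of_le_one hα0 hα1.le (Nat.le_succ k)) ?_ (by positivity)
    (by positivity)
  split_ifs <;> norm_num

/-- Two distinct letters cannot both have large weight. -/
theorem letterWeight_le_or (hα0 : 0 ≤ α) (hα1 : α < 1) (x y : ℕ → J) {i j : J} (hij : i ≠ j) :
    letterWeight α x y i ≤ α / (1 - α) ∨ letterWeight α x y j ≤ α / (1 - α) := by
  by_contra! h
  have hsum : letterWeight α x y i + letterWeight α x y j ≤ 2 * (α / (1 - α)) := by
    have hg : HasSum (fun k : ℕ => α ^ k * (2 * α)) ((1 - α)⁻¹ * (2 * α)) :=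
      (hasSum_geometric_of_lt_one hα0 hα1).mul_right _
    rw [letterWeight, letterWeight, ← (summable_letterWeight hα0 hα1 x y i).tsum_add
      (summable_letterWeight hα0 hα1 x y j)]
    refine ((((summable_letterWeight hα0 hα1 x y i).add
      (summable_letterWeight hα0 hα1 x y j)).tsum_le_tsum (fun k => ?_) hg.summable).trans_eq
      hg.tsum_eq).trans_eq (by rw [div_eq_mul_inv]; ring)
    rw [← mul_add, pow_succ, mul_assoc, mul_comm 2 α]
    gcongr
    -- At each position of an address at most one of the two letters occurs, so the weights share a
    -- total of `2α / (1 - α)`.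
    have hx : ∀ z : J, (if z = i then (1 : ℝ) else 0) + (if z = j then 1 else 0) ≤ 1 := by
      intro z
      split_ifs with h1 h2
      · exact absurd (h1.symm.trans h2) hij
      all_goals norm_num
    linarith [hx (x (k + 1)), hx (y (k + 1))]
  linarith

/-- The difference is affine in `v l`. The position `0` contributes the identity, from `x` alone,
and all later positions contribute an operator of norm at most the letter weight. -/
theorem le_norm_codingMap_sub_update [Finite J] (hα0 : 0 ≤ α) (hα1 : α < 1)
    (hα : ∀ i u, ‖Matrix.toEuclideanLin (A i : Matrix (Fin d) (Fin d) ℝ) u‖ ≤ α * ‖u‖)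
    {x y : ℕ → J} {l : J} (hx : x 0 = l) (hy : y 0 ≠ l) {β : ℝ} (hβ : letterWeight α x y l ≤ β)
    (v : J → EuclideanSpace ℝ (Fin d)) (a b : EuclideanSpace ℝ (Fin d)) :
    (1 - β) * ‖a - b‖ ≤
      ‖(codingMap A (Function.update v l a) x - codingMap A (Function.update v l a) y) -
        (codingMap A (Function.update v l b) x - codingMap A (Function.update v l b) y)‖ := by
  set t : ℕ → EuclideanSpace ℝ (Fin d) := fun k =>
    (prodLin A (initialWord x k) (Function.update v l a (x k)) -
      prodLin A (initialWord y k) (Function.update v l a (y k))) -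
    (prodLin A (initialWord x k) (Function.update v l b (x k)) -
      prodLin A (initialWord y k) (Function.update v l b (y k))) with ht
  have s1 := summable_codingMap hα0 hα1 hα (Function.update v l a) x
  have s2 := summable_codingMap hα0 hα1 hα (Function.update v l a) y
  have s3 := summable_codingMap hα0 hα1 hα (Function.update v l b) x
  have s4 := summable_codingMap hα0 hα1 hα (Function.update v l b) y
  have hs : Summable t := (s1.sub s2).sub (s3.sub s4)
  have e1 : (codingMap A (Function.update v l a) x - codingMap A (Function.update v l a) y) -
      (codingMap A (Function.update v l b) x - codingMap A (Function.update v l b) y) =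
      ∑' k, t k := by
    rw [ht, (s1.sub s2).tsum_sub (s3.sub s4), s1.tsum_sub s2, s3.tsum_sub s4]
    rfl
  have t0 : t 0 = a - b := by
    simp [ht, initialWord, prodLin_nil, hx, hy]
  have hone : ∀ (z : ℕ → J) (k : ℕ),
      ‖prodLin A (initialWord z k) (Function.update v l a (z k)) -
        prodLin A (initialWord z k) (Function.update v l b (z k))‖ ≤
        α ^ k * (if z k = l then 1 else 0) * ‖a - b‖ := by
    intro z k
    split_ifs with h
    · rw [← map_sub, h, Function.update_self, Function.update_self, mul_one]
      simpa [length_initialWord] using norm_prodLin_le hα0 hα (initialWord z k) (a - b)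
    · simp [h]
  have htail : ‖∑' k, t (k + 1)‖ ≤ letterWeight α x y l * ‖a - b‖ := by
    refine tsum_of_norm_bounded
      ((summable_letterWeight hα0 hα1 x y l).hasSum.mul_right ‖a - b‖) fun k => ?_
    have h1 := hone x (k + 1)
    have h2 := hone y (k + 1)
    rw [ht]
    simp only
    rw [sub_sub_sub_comm]
    refine (norm_sub_le _ _).trans ((add_le_add h1 h2).trans_eq ?_)
    ring
  rw [e1, hs.tsum_eq_zero_add, t0]
  have h3 := norm_sub_le (a - b + ∑' k, t (k + 1)) (∑' k, t (k + 1))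
  rw [add_sub_cancel_right] at h3
  nlinarith [mul_le_mul_of_nonneg_right hβ (norm_nonneg (a - b))]

/-- For addresses with distinct first letters, the difference of the coded points depends on some
translation vector in an expanding manner. -/
theorem exists_antilipschitzWith [Finite J] (hα0 : 0 ≤ α) (hα1 : α < 1 / 2)
    (hα : ∀ i u, ‖Matrix.toEuclideanLin (A i : Matrix (Fin d) (Fin d) ℝ) u‖ ≤ α * ‖u‖)
    {x y : ℕ → J} (hxy : x 0 ≠ y 0) :
    ∃ l : J, ∀ v : J → EuclideanSpace ℝ (Fin d),
      AntilipschitzWith (Real.toNNReal (1 - α / (1 - α))⁻¹) fun a =>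
        codingMap A (Function.update v l a) x - codingMap A (Function.update v l a) y := by
  -- This inequality is equivalent to `α < 1 / 2`.
  have hβ : α / (1 - α) < 1 := by
    rw [div_lt_one (by linarith)]; linarith
  have hβ' : 0 < 1 - α / (1 - α) := by linarith
  have main : ∃ l : J, ∀ (v : J → EuclideanSpace ℝ (Fin d)) a b,
      (1 - α / (1 - α)) * ‖a - b‖ ≤
      ‖(codingMap A (Function.update v l a) x - codingMap A (Function.update v l a) y) -
        (codingMap A (Function.update v l b) x - codingMap A (Function.update v l b) y)‖ := by
    rcases letterWeight_le_or hα0 (by linarith) x y hxy with h | h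
    · exact ⟨x 0, le_norm_codingMap_sub_update hα0 (by linarith) hα rfl hxy.symm h⟩
    · refine ⟨y 0, fun v a b => ?_⟩
      have h' : letterWeight α y x (y 0) ≤ α / (1 - α) := by
        rw [letterWeight] at h ⊢
        simpa only [add_comm] using h
      have := le_norm_codingMap_sub_update hα0 (by linarith) hα rfl hxy h' v a b
      refine this.trans_eq ?_
      rw [← norm_neg]
      congr 1
      abel
  obtain ⟨l, hl⟩ := main
  refine ⟨l, fun v => AntilipschitzWith.of_le_mul_dist fun a b => ?_⟩
  rw [dist_eq_norm, dist_eq_norm, Real.coe_toNNReal _ (inv_nonneg.2 hβ'.le),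
    le_inv_mul_iff₀ hβ']
  exact hl v a b

end Transversality

/-! ### Probability that two coded points are close -/

section Probability

/-- Volume is a multiple of `d`-dimensional Hausdorff measure, which scales by at most `K^d` under
preimages. -/
theorem volume_preimage_le_of_antilipschitzWith {d : ℕ} {K : ℝ≥0}
    {f : EuclideanSpace ℝ (Fin d) → EuclideanSpace ℝ (Fin d)} (hf : AntilipschitzWith K f)
    (S : Set (EuclideanSpace ℝ (Fin d))) :
    volume (f ⁻¹' S) ≤ (K : ℝ≥0∞) ^ d * volume S := by
  have h := Measure.isAddLeftInvariant_eq_smul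
    (volume : Measure (EuclideanSpace ℝ (Fin d))) (Measure.hausdorffMeasure d)
  have h1 := hf.hausdorffMeasure_preimage_le (d := (d : ℝ)) (Nat.cast_nonneg d) S
  rw [h, Measure.smul_apply, Measure.smul_apply, mul_smul_comm]
  rw [ENNReal.rpow_natCast] at h1
  gcongr

/-- Fubini: all coordinates except `l` are frozen, and the bound holds on every section. -/
theorem measure_pi_le_of_forall_update {J : Type*} [Fintype J] [DecidableEq J] {X : J → Type*}
    [∀ i, MeasurableSpace (X i)] (μ : ∀ i, Measure (X i)) [∀ i, IsProbabilityMeasure (μ i)]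
    {S : Set (∀ i, X i)} (hS : MeasurableSet S) (l : J) {b : ℝ≥0∞}
    (h : ∀ v : ∀ i, X i, μ l {a | Function.update v l a ∈ S} ≤ b) : Measure.pi μ S ≤ b := by
  rw [← lintegral_indicator_one hS]
  refine (lintegral_le_of_lmarginal_le (μ := μ) {l} (g := fun _ => b)
    (measurable_one.indicator hS) measurable_const fun v => ?_).trans_eq (by simp)
  rw [lmarginal_singleton, lmarginal_singleton, lintegral_const, measure_univ, mul_one]
  refine le_trans (le_of_eq ?_) (h v)
  rw [show {a | Function.update v l a ∈ S} = Function.update v l ⁻¹' S from rfl,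
    ← lintegral_indicator_one (measurable_update v hS)]
  rfl

theorem norm_le_of_mem_unitCube {d : ℕ} {x : EuclideanSpace ℝ (Fin d)} (hx : x ∈ unitCube d) :
    ‖x‖ ≤ √d := by
  rw [EuclideanSpace.norm_eq]
  refine Real.sqrt_le_sqrt ?_
  calc ∑ i, ‖x i‖ ^ 2 ≤ ∑ _i : Fin d, (1 : ℝ) := Finset.sum_le_sum fun i _ => by
        rw [Real.norm_of_nonneg (hx i).1]
        exact pow_le_one₀ (hx i).1 (hx i).2
    _ = d := by simp

theorem measurableSet_unitCube (d : ℕ) : MeasurableSet (unitCube d) := by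
  have : unitCube d = ⋂ k, {x : EuclideanSpace ℝ (Fin d) | x k ∈ Set.Icc (0 : ℝ) 1} := by
    ext x; simp [unitCube]
  rw [this]
  exact MeasurableSet.iInter fun k =>
    (EuclideanSpace.proj (𝕜 := ℝ) k).continuous.measurable measurableSet_Icc

variable {d : ℕ} {J : Type*} [Fintype J] {A : J → GL (Fin d) ℝ} {α : ℝ}

theorem ae_mem_unitCube :
    ∀ᵐ v ∂(Measure.pi fun _ : J => cubeMeasure d), ∀ i, v i ∈ unitCube d := by
  rw [ae_all_iff]
  intro i
  have h : ∀ᵐ a ∂(cubeMeasure d), a ∈ unitCube d :=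
    ae_restrict_mem (measurableSet_unitCube d)
  exact Measure.tendsto_eval_ae_ae.eventually h

/-- The probability that two points of the self-affine set are within `r` of each other. -/
theorem exists_measure_norm_codingMap_sub_le [MeasurableSpace J] [DiscreteMeasurableSpace J]
    (hα0 : 0 ≤ α) (hα1 : α < 1 / 2)
    (hα : ∀ i u, ‖Matrix.toEuclideanLin (A i : Matrix (Fin d) (Fin d) ℝ) u‖ ≤ α * ‖u‖)
    {t : ℝ≥0} (ht : ⌊t⌋₊ < d) :
    ∃ C : ℝ≥0∞, C ≠ ∞ ∧ ∀ (r : ℝ), 0 < r → ∀ (x y : ℕ → J) (n : ℕ), (∀ k < n, x k = y k) →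
      x n ≠ y n → (Measure.pi fun _ : J => cubeMeasure d)
        {v | ‖codingMap A v x - codingMap A v y‖ ≤ r} ≤
          C * (ENNReal.ofReal (r ^ (t : ℝ)) * (svfWeight A t (initialWord x n))⁻¹) := by
  classical
  -- Coded points have norm at most `√d / (1 - α)` for translations in the cube; twice this bounds a
  -- difference, and `1 ≤ R` is needed for the volume bound.
  set R : ℝ := max 1 (2 * ((1 - α)⁻¹ * √d)) with hR
  set K : ℝ≥0 := Real.toNNReal (1 - α / (1 - α))⁻¹ with hK
  refine ⟨(K : ℝ≥0∞) ^ d * ENNReal.ofReal ((2 * R) ^ d),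
    ENNReal.mul_ne_top (ENNReal.pow_ne_top ENNReal.coe_ne_top) ENNReal.ofReal_ne_top,
    fun r hr x y n hxy hn => ?_⟩
  obtain ⟨l, hl⟩ := exists_antilipschitzWith (A := A) hα0 hα1 hα
    (x := fun j => x (n + j)) (y := fun j => y (n + j)) (by simpa using hn)
  have hm : ∀ z : ℕ → J, Measurable fun v => codingMap A v z := by
    intro z
    have h := (measurable_codingMap hα0 (by linarith) hα).comp
      (measurable_prodMk_right (α := J → EuclideanSpace ℝ (Fin d)) (y := z))
    simpa only [Function.comp_def] using h
  set S : Set (J → EuclideanSpace ℝ (Fin d)) :=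
    {v | ‖codingMap A v x - codingMap A v y‖ ≤ r} ∩ {v | ∀ i, v i ∈ unitCube d} with hS
  have hSm : MeasurableSet S := by
    refine MeasurableSet.inter (measurableSet_le ((hm x).sub (hm y)).norm measurable_const) ?_
    rw [Set.ofPred_forall]
    exact MeasurableSet.iInter fun i => measurable_pi_apply i (measurableSet_unitCube d)
  have hSle : (Measure.pi fun _ : J => cubeMeasure d)
      {v | ‖codingMap A v x - codingMap A v y‖ ≤ r} ≤
      (Measure.pi fun _ : J => cubeMeasure d) S := by
    refine measure_mono_ae ?_
    filter_upwards [ae_mem_unitCube] with v hv hv'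
    exact ⟨hv', hv⟩
  refine hSle.trans (measure_pi_le_of_forall_update _ hSm l fun v => ?_)
  set M := ((initialWord x n).map A).prod with hM
  set U := {u : EuclideanSpace ℝ (Fin d) |
    ‖u‖ ≤ R ∧ ‖Matrix.toEuclideanLin (M : Matrix (Fin d) (Fin d) ℝ) u‖ ≤ r} with hU
  have hsub : {a | Function.update v l a ∈ S} ⊆
      (fun a => codingMap A (Function.update v l a) (fun j => x (n + j)) -
        codingMap A (Function.update v l a) fun j => y (n + j)) ⁻¹' U := by
    rintro a ⟨ha, hc⟩
    have hb : ∀ i, ‖Function.update v l a i‖ ≤ √d := fun i => norm_le_of_mem_unitCube (hc i)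
    refine ⟨(norm_sub_le _ _).trans (le_trans ?_ (le_max_right _ _)), ?_⟩
    · have h1 := norm_codingMap_le hα0 (by linarith) hα hb (fun j => x (n + j))
      have h2 := norm_codingMap_le hα0 (by linarith) hα hb (fun j => y (n + j))
      linarith
    · rw [Set.mem_ofPred_eq, codingMap_sub_eq hα0 (by linarith) hα _ hxy] at ha
      exact ha
  calc cubeMeasure d {a | Function.update v l a ∈ S}
      ≤ volume {a | Function.update v l a ∈ S} := Measure.restrict_apply_le _ _
    _ ≤ _ := measure_mono hsub
    _ ≤ (K : ℝ≥0∞) ^ d * volume U := volume_preimage_le_of_antilipschitzWith (hl v) U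
    _ ≤ (K : ℝ≥0∞) ^ d * ENNReal.ofReal ((2 * R) ^ d *
          (r ^ (t : ℝ) / svf t (M : Matrix (Fin d) (Fin d) ℝ))) := by
        gcongr
        exact volume_ball_inter_preimage_le_svf ht M (le_max_left _ _) hr
    _ = _ := by
        rw [ENNReal.ofReal_mul (by positivity), ENNReal.ofReal_div_of_pos (svf_pos ht M),
          div_eq_mul_inv, mul_assoc, svfWeight, hM]

end Probability

/-! ### Mass distribution principle -/

section MassDistribution

/-- A radius lies within a factor `2` of a dyadic one, which costs `2 ^ τ`; at `δ = 0` the dyadic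
bounds tend to `0`. -/
theorem measure_le_of_forall_dyadic {X : Type*} [MeasurableSpace X] {μ : Measure X}
    {ρ : X → ℝ≥0∞} {τ : ℝ} (hτ : 0 < τ) {M : ℝ≥0∞} (hM : M ≠ ∞)
    (h : ∀ n : ℕ, ((2 : ℝ≥0∞) ^ n) ^ τ * μ {y | ρ y ≤ ((2 : ℝ≥0∞) ^ n)⁻¹} ≤ M)
    {δ : ℝ≥0∞} (hδ : δ ≤ 1) : μ {y | ρ y ≤ δ} ≤ M * 2 ^ τ * δ ^ τ := by
  have h' : ∀ n : ℕ, μ {y | ρ y ≤ ((2 : ℝ≥0∞) ^ n)⁻¹} ≤ M * (((2 : ℝ≥0∞) ^ n)⁻¹) ^ τ := by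
    intro n
    have h0 : ((2 : ℝ≥0∞) ^ n) ^ τ ≠ 0 := by simp
    have ht : ((2 : ℝ≥0∞) ^ n) ^ τ ≠ ∞ :=
      ENNReal.rpow_ne_top_of_nonneg hτ.le (ENNReal.pow_ne_top ENNReal.ofNat_ne_top)
    rw [ENNReal.inv_rpow, mul_comm M, ← ENNReal.mul_le_iff_le_inv h0 ht]
    exact h n
  rcases eq_or_ne δ 0 with rfl | hδ0
  · rw [ENNReal.zero_rpow_of_pos hτ, mul_zero]
    have hlim : Tendsto (fun n : ℕ => M * (((2 : ℝ≥0∞) ^ n)⁻¹) ^ τ) atTop (𝓝 (M * 0)) := by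
      refine ENNReal.Tendsto.const_mul ?_ (Or.inr hM)
      have h1 : Tendsto (fun n : ℕ => ((2 : ℝ≥0∞) ^ n)⁻¹) atTop (𝓝 0) := by
        simp_rw [ENNReal.inv_pow]
        exact ENNReal.tendsto_pow_atTop_nhds_zero_of_lt_one ENNReal.one_half_lt_one
      have h2 := ((ENNReal.continuous_rpow_const (y := τ)).tendsto 0).comp h1
      rwa [ENNReal.zero_rpow_of_pos hτ] at h2
    rw [mul_zero] at hlim
    refine ge_of_tendsto' hlim fun n => le_trans (measure_mono fun y hy => ?_) (h' n)
    rw [Set.mem_ofPred_eq] at hy ⊢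
    exact hy.trans zero_le
  · have hδt : δ ≠ ∞ := ne_top_of_le_ne_top ENNReal.one_ne_top hδ
    obtain ⟨n, hn1, hn2⟩ := exists_nat_pow_near_of_lt_one
      (ENNReal.toReal_pos hδ0 hδt) (ENNReal.toReal_le_of_le_ofReal zero_le_one (by simpa using hδ))
      (one_half_pos (α := ℝ)) one_half_lt_one
    have e : ∀ k : ℕ, ENNReal.ofReal ((1 / 2 : ℝ) ^ k) = ((2 : ℝ≥0∞) ^ k)⁻¹ := by
      intro k
      rw [ENNReal.ofReal_pow (by norm_num), one_div, ENNReal.ofReal_inv_of_pos two_pos,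
        ENNReal.ofReal_ofNat, ENNReal.inv_pow]
    have g1 : ((2 : ℝ≥0∞) ^ (n + 1))⁻¹ ≤ δ := by
      rw [← e]; exact ENNReal.ofReal_le_of_le_toReal hn1.le
    have g2 : δ ≤ ((2 : ℝ≥0∞) ^ n)⁻¹ := by
      rw [← e, ← ENNReal.ofReal_toReal hδt]; exact ENNReal.ofReal_le_ofReal hn2
    have g3 : ((2 : ℝ≥0∞) ^ n)⁻¹ ≤ 2 * δ := by
      calc ((2 : ℝ≥0∞) ^ n)⁻¹ = 2 * ((2 : ℝ≥0∞) ^ (n + 1))⁻¹ := by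
            rw [pow_succ', ENNReal.mul_inv (Or.inl two_ne_zero) (Or.inl ENNReal.ofNat_ne_top),
              ← mul_assoc, ENNReal.mul_inv_cancel two_ne_zero ENNReal.ofNat_ne_top, one_mul]
        _ ≤ 2 * δ := by gcongr
    calc μ {y | ρ y ≤ δ} ≤ μ {y | ρ y ≤ ((2 : ℝ≥0∞) ^ n)⁻¹} :=
          measure_mono fun y hy => le_trans hy g2
      _ ≤ M * (((2 : ℝ≥0∞) ^ n)⁻¹) ^ τ := h' n
      _ ≤ M * (2 * δ) ^ τ := by gcongr
      _ = M * 2 ^ τ * δ ^ τ := by rw [ENNReal.mul_rpow_of_nonneg _ _ hτ.le, mul_assoc]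

/-- If the image of `μ` under `f` has finite discrete `τ`-potential almost everywhere, then the
range of `f` has Hausdorff dimension at least `τ`. -/
theorem le_dimH_range_of_ae_potential_lt_top {Ω E : Type*} [MeasurableSpace Ω] [EMetricSpace E]
    [MeasurableSpace E] [BorelSpace E] {μ : Measure Ω} [NeZero μ] {f : Ω → E} (hf : Measurable f)
    {τ : ℝ≥0} (hτ : 0 < τ)
    (h : ∀ᵐ x ∂μ, ∑' n : ℕ, ((2 : ℝ≥0∞) ^ n) ^ (τ : ℝ) *
      μ {y | edist (f x) (f y) ≤ ((2 : ℝ≥0∞) ^ n)⁻¹} < ∞) :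
    (τ : ℝ≥0∞) ≤ dimH (Set.range f) := by
  set g : Ω → ℝ≥0∞ := fun x => ∑' n : ℕ, ((2 : ℝ≥0∞) ^ n) ^ (τ : ℝ) *
      μ {y | edist (f x) (f y) ≤ ((2 : ℝ≥0∞) ^ n)⁻¹} with hg
  -- The potential is finite almost everywhere, hence bounded by some `M` on a set of positive
  -- measure.
  obtain ⟨M, hM⟩ : ∃ M : ℕ, μ {x | g x ≤ M} ≠ 0 := by
    by_contra! hcon
    have hU : μ (⋃ M : ℕ, {x | g x ≤ M}) = 0 := measure_iUnion_null hcon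
    have huniv : μ Set.univ = 0 := by
      refine le_antisymm ((measure_mono_ae ?_).trans hU.le) zero_le
      filter_upwards [h] with x hx _
      obtain ⟨M, hM⟩ := ENNReal.exists_nat_gt hx.ne
      exact Set.mem_iUnion.2 ⟨M, hM.le⟩
    exact NeZero.ne μ (Measure.measure_univ_eq_zero.1 huniv)
  set G := {x | g x ≤ M} with hG
  set D : ℝ≥0∞ := (M + 1) * 2 ^ (τ : ℝ) with hD
  have hM1 : (M + 1 : ℝ≥0∞) ≠ ∞ :=
    ENNReal.add_ne_top.2 ⟨ENNReal.natCast_ne_top M, ENNReal.one_ne_top⟩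
  have hDt : D ≠ ∞ :=
    ENNReal.mul_ne_top hM1 (ENNReal.rpow_ne_top_of_nonneg τ.2 ENNReal.ofNat_ne_top)
  have hD0 : D ≠ 0 := mul_ne_zero (by simp) (by simp)
  have hle : D⁻¹ • (μ.restrict G).map f ≤ Measure.hausdorffMeasure (τ : ℝ) := by
    refine Measure.le_hausdorffMeasure _ _ 1 one_pos fun s hs => ?_
    rw [Measure.smul_apply, smul_eq_mul, mul_comm, ← div_eq_mul_inv]
    refine ENNReal.div_le_of_le_mul ?_
    -- The closure is measurable and has the same diameter.
    refine (measure_mono (subset_closure (s := s))).trans ?_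
    rw [Measure.map_apply hf isClosed_closure.measurableSet,
      Measure.restrict_apply (hf isClosed_closure.measurableSet)]
    rcases Set.eq_empty_or_nonempty (f ⁻¹' closure s ∩ G) with hemp | ⟨x, hx, hxG⟩
    · rw [hemp, measure_empty]; exact zero_le
    have hsub : f ⁻¹' closure s ∩ G ⊆ {y | edist (f x) (f y) ≤ Metric.ediam s} := by
      rintro y ⟨hy, _⟩
      rw [← Metric.ediam_closure]
      exact Metric.edist_le_ediam_of_mem hx hy
    refine (measure_mono hsub).trans ?_
    rw [mul_comm, hD]
    refine measure_le_of_forall_dyadic (NNReal.coe_pos.2 hτ) hM1 (fun n => ?_) hs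
    exact ((ENNReal.le_tsum n).trans hxG).trans le_self_add
  refine le_dimH_of_hausdorffMeasure_ne_zero ?_
  refine (lt_of_lt_of_le ?_ (hle (Set.range f))).ne'
  rw [Measure.smul_apply, smul_eq_mul]
  refine ENNReal.mul_pos (ENNReal.inv_ne_zero.2 hDt) ?_
  refine (lt_of_lt_of_le ?_ (Measure.le_map_apply hf.aemeasurable _)).ne'
  rw [Set.preimage_range, Measure.restrict_apply_univ]
  exact pos_iff_ne_zero.2 hM

end MassDistribution

/-! ### Energy estimate for finite systems -/

section FiniteSystems

variable {d : ℕ} {J : Type*} {A : J → GL (Fin d) ℝ} {α : ℝ}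

theorem svfWeight_le_one (hα0 : 0 ≤ α) (hα1 : α < 1)
    (hα : ∀ i u, ‖Matrix.toEuclideanLin (A i : Matrix (Fin d) (Fin d) ℝ) u‖ ≤ α * ‖u‖)
    {t : ℝ≥0} (ht : ⌊t⌋₊ < d) (w : List J) : svfWeight A t w ≤ 1 := by
  have h := svf_le_rpow ht (w.map A).prod (norm_prodLin_le hα0 hα w)
  rw [svfWeight, ← ENNReal.ofReal_one]
  exact ENNReal.ofReal_le_ofReal (h.trans
    (Real.rpow_le_one (by positivity) (pow_le_one₀ hα0 hα1.le) t.2))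

theorem svfWeight_le_mul (hα0 : 0 ≤ α)
    (hα : ∀ i u, ‖Matrix.toEuclideanLin (A i : Matrix (Fin d) (Fin d) ℝ) u‖ ≤ α * ‖u‖)
    {s t : ℝ≥0} (hs : ⌊s⌋₊ < d) (hst : ⌊t⌋₊ = ⌊s⌋₊) (hts : t ≤ s) (w : List J) :
    svfWeight A s w ≤ ENNReal.ofReal (α ^ ((s : ℝ) - t)) ^ w.length * svfWeight A t w := by
  have h := svf_le_rpow_mul_svf hs hst hts (w.map A).prod (norm_prodLin_le hα0 hα w)
  rw [svfWeight, svfWeight, ← ENNReal.ofReal_pow (by positivity),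
    ← ENNReal.ofReal_mul (by positivity), ← Real.rpow_natCast, ← Real.rpow_mul hα0,
    mul_comm _ (w.length : ℝ), Real.rpow_mul hα0, Real.rpow_natCast]
  exact ENNReal.ofReal_le_ofReal h

variable [Fintype J] [MeasurableSpace J] [DiscreteMeasurableSpace J]

/-- The sum of `1 / φ^t` over the common initial words of `x` and `y`. -/
def commonWeight (A : J → GL (Fin d) ℝ) (t : ℝ≥0) (x y : ℕ → J) : ℝ≥0∞ :=
  ∑' n : ℕ, {y | initialWord y n = initialWord x n}.indicator
    (fun _ => (svfWeight A t (initialWord x n))⁻¹) y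

theorem exists_measure_edist_codingMap_le (hα0 : 0 ≤ α) (hα1 : α < 1 / 2)
    (hα : ∀ i u, ‖Matrix.toEuclideanLin (A i : Matrix (Fin d) (Fin d) ℝ) u‖ ≤ α * ‖u‖)
    {t : ℝ≥0} (ht : ⌊t⌋₊ < d) :
    ∃ C : ℝ≥0∞, C ≠ ∞ ∧ ∀ (r : ℝ≥0), r ≠ 0 → ∀ x y : ℕ → J,
      (Measure.pi fun _ : J => cubeMeasure d)
        {v | edist (codingMap A v x) (codingMap A v y) ≤ r} ≤
          C * ((r : ℝ≥0∞) ^ (t : ℝ) * commonWeight A t x y) := by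
  classical
  obtain ⟨C, hC, h⟩ := exists_measure_norm_codingMap_sub_le hα0 hα1 hα ht
  -- Adding `1` makes the constant nonzero, so that for `x = y`, where the common weight is
  -- infinite, the right side is `∞`.
  refine ⟨C + 1, ENNReal.add_ne_top.2 ⟨hC, ENNReal.one_ne_top⟩, fun r hr x y => ?_⟩
  by_cases hxy : x = y
  · have htop : commonWeight A t x y = ∞ := by
      rw [eq_top_iff, ← ENNReal.tsum_const_eq_top_of_ne_zero (α := ℕ) one_ne_zero]
      refine ENNReal.tsum_le_tsum fun n => ?_
      rw [Set.indicator_of_mem (by rw [hxy]; rfl), ENNReal.one_le_inv]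
      exact svfWeight_le_one hα0 (by linarith) hα ht _
    have hr' : (r : ℝ≥0∞) ^ (t : ℝ) ≠ 0 := by
      rw [← ENNReal.coe_rpow_of_ne_zero hr]
      exact_mod_cast (NNReal.rpow_pos (pos_iff_ne_zero.2 hr)).ne'
    rw [htop, ENNReal.mul_top hr', ENNReal.mul_top (by simp)]
    exact le_top
  · have hex : ∃ n, x n ≠ y n := Function.ne_iff.1 hxy
    have h1 := h r (NNReal.coe_pos.2 (pos_iff_ne_zero.2 hr)) x y (Nat.find hex)
      (fun k hk => not_not.1 (Nat.find_min hex hk)) (Nat.find_spec hex)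
    have e : {v | edist (codingMap A v x) (codingMap A v y) ≤ r} =
        {v | ‖codingMap A v x - codingMap A v y‖ ≤ r} := by
      ext v
      rw [Set.mem_ofPred_eq, Set.mem_ofPred_eq, edist_nndist, ENNReal.coe_le_coe,
        ← NNReal.coe_le_coe, coe_nndist, dist_eq_norm]
    rw [e]
    refine h1.trans (mul_le_mul' le_self_add (mul_le_mul' (le_of_eq ?_) ?_))
    · rw [← ENNReal.ofReal_rpow_of_pos (NNReal.coe_pos.2 (pos_iff_ne_zero.2 hr)),
        ENNReal.ofReal_coe_nnreal]
    -- Only the term of the longest common prefix is needed.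
    · refine le_trans (le_of_eq ?_) (ENNReal.le_tsum (Nat.find hex))
      rw [Set.indicator_of_mem]
      exact (initialWord_eq_of_forall
        fun k hk => not_not.1 (Nat.find_min hex hk)).symm

/-- Level `n` contributes `μ[w] / φ^t ≤ C φ^s / φ^t ≤ C α^(n(s-t))`, where `w` is the prefix of `x`
of length `n`. -/
theorem lintegral_commonWeight_le (hα0 : 0 ≤ α)
    (hα : ∀ i u, ‖Matrix.toEuclideanLin (A i : Matrix (Fin d) (Fin d) ℝ) u‖ ≤ α * ‖u‖)
    {s t : ℝ≥0} (hs : ⌊s⌋₊ < d) (hst : ⌊t⌋₊ = ⌊s⌋₊) (hts : t ≤ s) {μ : Measure (ℕ → J)}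
    {C : ℝ≥0∞} (hμ : ∀ n w, w.length = n → μ {x | initialWord x n = w} ≤ C * svfWeight A s w)
    (x : ℕ → J) :
    ∫⁻ y, commonWeight A t x y ∂μ ≤ C * (1 - ENNReal.ofReal (α ^ ((s : ℝ) - t)))⁻¹ := by
  have hm : ∀ n, MeasurableSet {y : ℕ → J | initialWord y n = initialWord x n} :=
    fun n => measurableSet_initialWord_eq n _
  simp only [commonWeight]
  rw [lintegral_tsum fun n => (measurable_const.indicator (hm n)).aemeasurable,
    ← ENNReal.tsum_geometric, ← ENNReal.tsum_mul_left]
  refine ENNReal.tsum_le_tsum fun n => ?_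
  rw [lintegral_indicator_const (hm n)]
  set w := initialWord x n with hw
  have h1 : svfWeight A t w ≠ 0 := svfWeight_ne_zero (hst ▸ hs) A w
  have h2 : svfWeight A t w ≠ ∞ := svfWeight_ne_top t A w
  calc (svfWeight A t w)⁻¹ * μ {y | initialWord y n = w}
      ≤ (svfWeight A t w)⁻¹ * (C * (ENNReal.ofReal (α ^ ((s : ℝ) - t)) ^ n * svfWeight A t w)) := by
        gcongr
        refine (hμ n w (length_initialWord x n)).trans ?_
        gcongr
        simpa only [hw, length_initialWord] using svfWeight_le_mul hα0 hα hs hst hts w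
    _ = C * ENNReal.ofReal (α ^ ((s : ℝ) - t)) ^ n * ((svfWeight A t w)⁻¹ * svfWeight A t w) := by
        ring
    _ = _ := by rw [ENNReal.inv_mul_cancel h1 h2, mul_one]

theorem measurable_codingMap_left (hα0 : 0 ≤ α) (hα1 : α < 1)
    (hα : ∀ i u, ‖Matrix.toEuclideanLin (A i : Matrix (Fin d) (Fin d) ℝ) u‖ ≤ α * ‖u‖)
    (v : J → EuclideanSpace ℝ (Fin d)) : Measurable (codingMap A v) := by
  have h := (measurable_codingMap hα0 hα1 hα).comp (measurable_prodMk_left (x := v))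
  simpa only [Function.comp_def] using h

theorem measurableSet_edist_codingMap_le (hα0 : 0 ≤ α) (hα1 : α < 1)
    (hα : ∀ i u, ‖Matrix.toEuclideanLin (A i : Matrix (Fin d) (Fin d) ℝ) u‖ ≤ α * ‖u‖)
    (r : ℝ≥0∞) :
    MeasurableSet {p : ((J → EuclideanSpace ℝ (Fin d)) × (ℕ → J)) × (ℕ → J) |
      edist (codingMap A p.1.1 p.1.2) (codingMap A p.1.1 p.2) ≤ r} := by
  have h := measurable_codingMap hα0 hα1 hα
  have h1 : Measurable fun p : ((J → EuclideanSpace ℝ (Fin d)) × (ℕ → J)) × (ℕ → J) =>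
      codingMap A p.1.1 p.1.2 := by
    simpa only [Function.comp_def] using h.comp measurable_fst
  have hq : Measurable fun p : ((J → EuclideanSpace ℝ (Fin d)) × (ℕ → J)) × (ℕ → J) =>
      (p.1.1, p.2) := (measurable_fst.comp measurable_fst).prodMk measurable_snd
  have h2 : Measurable fun p : ((J → EuclideanSpace ℝ (Fin d)) × (ℕ → J)) × (ℕ → J) =>
      codingMap A p.1.1 p.2 := by
    simpa only [Function.comp_def] using h.comp hq
  exact measurableSet_le (h1.edist h2) measurable_const

theorem lintegral_measure_edist_le (hα0 : 0 ≤ α) (hα1 : α < 1)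
    (hα : ∀ i u, ‖Matrix.toEuclideanLin (A i : Matrix (Fin d) (Fin d) ℝ) u‖ ≤ α * ‖u‖)
    {μ : Measure (ℕ → J)} [IsProbabilityMeasure μ]
    {P : Measure (J → EuclideanSpace ℝ (Fin d))} [IsProbabilityMeasure P] {r B : ℝ≥0∞}
    (hB : ∀ x, ∫⁻ y, P {v | edist (codingMap A v x) (codingMap A v y) ≤ r} ∂μ ≤ B) :
    ∫⁻ p, μ {y | edist (codingMap A p.1 p.2) (codingMap A p.1 y) ≤ r} ∂(P.prod μ) ≤ B := by
  have hm := measurableSet_edist_codingMap_le (A := A) hα0 hα1 hα r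
  have hf : Measurable fun p : (J → EuclideanSpace ℝ (Fin d)) × (ℕ → J) =>
      μ {y | edist (codingMap A p.1 p.2) (codingMap A p.1 y) ≤ r} :=
    measurable_measure_prodMk_left hm
  rw [lintegral_prod_symm _ hf.aemeasurable]
  refine (lintegral_mono (g := fun _ => B) fun x => ?_).trans_eq (by simp)
  refine le_trans (le_of_eq ?_) (hB x)
  have hS : MeasurableSet {q : (J → EuclideanSpace ℝ (Fin d)) × (ℕ → J) |
      edist (codingMap A q.1 x) (codingMap A q.1 q.2) ≤ r} := by
    have hq : Measurable fun q : (J → EuclideanSpace ℝ (Fin d)) × (ℕ → J) => ((q.1, x), q.2) :=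
      (measurable_fst.prodMk measurable_const).prodMk measurable_snd
    exact hq hm
  exact (Measure.prod_apply hS).symm.trans (Measure.prod_apply_symm hS)

/-- Almost every finite self-affine set whose pressure at `s` is nonnegative has dimension at
least `τ < s`. -/
theorem ae_le_dimH_range_codingMap [Nonempty J] (hα0 : 0 ≤ α) (hα1 : α < 1 / 2)
    (hα : ∀ i u, ‖Matrix.toEuclideanLin (A i : Matrix (Fin d) (Fin d) ℝ) u‖ ≤ α * ‖u‖)
    {τ t s : ℝ≥0} (hs : ⌊s⌋₊ < d) (hfl : ⌊t⌋₊ = ⌊s⌋₊) (hτ : 0 < τ) (hτt : τ < t) (hts : t < s)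
    (hP : ¬ pressure A s < 0) :
    ∀ᵐ v ∂(Measure.pi fun _ : J => cubeMeasure d),
      (τ : ℝ≥0∞) ≤ dimH (Set.range (codingMap A v)) := by
  obtain ⟨μ, C₁, hμp, hC₁, hμ⟩ := exists_measure_le_svfWeight hs hP
  obtain ⟨C₂, hC₂, hC⟩ := exists_measure_edist_codingMap_le hα0 hα1 hα (hfl ▸ hs)
  set P := Measure.pi fun _ : J => cubeMeasure d with hPdef
  have hα1' : α < 1 := by linarith
  set I := C₁ * (1 - ENNReal.ofReal (α ^ ((s : ℝ) - t)))⁻¹ with hI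
  have hIt : I ≠ ∞ := by
    refine ENNReal.mul_ne_top hC₁ (ENNReal.inv_ne_top.2 (tsub_pos_of_lt ?_).ne')
    rw [ENNReal.ofReal_lt_one]
    exact Real.rpow_lt_one hα0 hα1' (sub_pos.2 (NNReal.coe_lt_coe.2 hts))
  have hr : ∀ n : ℕ, (((2 : ℝ≥0) ^ n)⁻¹ : ℝ≥0) ≠ 0 := fun n => by positivity
  have hrc : ∀ n : ℕ, ((((2 : ℝ≥0) ^ n)⁻¹ : ℝ≥0) : ℝ≥0∞) = ((2 : ℝ≥0∞) ^ n)⁻¹ := fun n => by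
    rw [ENNReal.coe_inv (by positivity)]; simp
  have hlevel : ∀ n : ℕ,
      ∫⁻ p, μ {y | edist (codingMap A p.1 p.2) (codingMap A p.1 y) ≤ ((2 : ℝ≥0∞) ^ n)⁻¹}
        ∂(P.prod μ) ≤ C₂ * ((((2 : ℝ≥0∞) ^ n)⁻¹) ^ (t : ℝ) * I) := by
    intro n
    refine lintegral_measure_edist_le hα0 hα1' hα fun x => ?_
    have hb := hC _ (hr n) x
    rw [hrc] at hb
    refine (lintegral_mono hb).trans ?_
    have hrt : (((2 : ℝ≥0∞) ^ n)⁻¹) ^ (t : ℝ) ≠ ∞ :=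
      ENNReal.rpow_ne_top_of_nonneg t.2 (by simp)
    rw [lintegral_const_mul' _ _ hC₂, lintegral_const_mul' _ _ hrt]
    gcongr
    exact lintegral_commonWeight_le hα0 hα hs hfl hts.le hμ x
  have hmeas : ∀ n : ℕ, Measurable fun p : (J → EuclideanSpace ℝ (Fin d)) × (ℕ → J) =>
      μ {y | edist (codingMap A p.1 p.2) (codingMap A p.1 y) ≤ ((2 : ℝ≥0∞) ^ n)⁻¹} := fun n =>
    measurable_measure_prodMk_left (measurableSet_edist_codingMap_le hα0 hα1' hα _)
  have htot : ∫⁻ p, ∑' n : ℕ, ((2 : ℝ≥0∞) ^ n) ^ (τ : ℝ) *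
      μ {y | edist (codingMap A p.1 p.2) (codingMap A p.1 y) ≤ ((2 : ℝ≥0∞) ^ n)⁻¹}
        ∂(P.prod μ) ≠ ∞ := by
    rw [lintegral_tsum fun n => ((hmeas n).const_mul _).aemeasurable]
    -- The gap `τ < t` makes the sum over scales geometric with ratio `2^(τ-t)`.
    have hle : ∀ n : ℕ, ∫⁻ p, ((2 : ℝ≥0∞) ^ n) ^ (τ : ℝ) *
        μ {y | edist (codingMap A p.1 p.2) (codingMap A p.1 y) ≤ ((2 : ℝ≥0∞) ^ n)⁻¹}
          ∂(P.prod μ) ≤ C₂ * I * ((2 : ℝ≥0∞) ^ ((τ : ℝ) - t)) ^ n := by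
      intro n
      rw [lintegral_const_mul _ (hmeas n)]
      calc _ ≤ ((2 : ℝ≥0∞) ^ n) ^ (τ : ℝ) * (C₂ * ((((2 : ℝ≥0∞) ^ n)⁻¹) ^ (t : ℝ) * I)) := by
            gcongr; exact hlevel n
        _ = C₂ * I * (((2 : ℝ≥0∞) ^ n) ^ (τ : ℝ) * (((2 : ℝ≥0∞) ^ n)⁻¹) ^ (t : ℝ)) := by ring
        _ = _ := by
            rw [ENNReal.inv_rpow, ← ENNReal.rpow_neg, ← ENNReal.rpow_add _ _ (by simp) (by simp),
              ← sub_eq_add_neg, ← ENNReal.rpow_natCast, ← ENNReal.rpow_natCast,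
              ← ENNReal.rpow_mul, ← ENNReal.rpow_mul, mul_comm (n : ℝ)]
    refine ne_top_of_le_ne_top ?_ (ENNReal.tsum_le_tsum hle)
    rw [ENNReal.tsum_mul_left, ENNReal.tsum_geometric]
    refine ENNReal.mul_ne_top (ENNReal.mul_ne_top hC₂ hIt)
      (ENNReal.inv_ne_top.2 (tsub_pos_of_lt ?_).ne')
    exact ENNReal.rpow_lt_one_of_one_lt_of_neg ENNReal.one_lt_two
      (sub_neg.2 (NNReal.coe_lt_coe.2 hτt))
  have hae := Measure.ae_ae_of_ae_prod (ae_lt_top (Measurable.tsum fun n =>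
    (hmeas n).const_mul (((2 : ℝ≥0∞) ^ n) ^ (τ : ℝ))) htot)
  filter_upwards [hae] with v hv
  exact le_dimH_range_of_ae_potential_lt_top (measurable_codingMap_left hα0 hα1' hα v) hτ hv

end FiniteSystems

/-! ### Reduction to finite subsystems -/

section Reduction

variable {d : ℕ}

theorem not_pressure_neg_of_lt_upperAffinityDim {J : Type*} {A : J → GL (Fin d) ℝ} {s : ℝ≥0}
    (h : (s : ℝ≥0∞) < upperAffinityDim A) : ¬ pressure A s < 0 := fun hP =>
  absurd (iInf₂_le s hP) (not_le.2 h)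

/-- The integer part does not change just above `τ`, so `s` is chosen below both `U` and `⌊τ⌋ + 1`.
-/
theorem exists_between_same_floor {τ : ℝ≥0} {U : ℝ≥0∞} (hd : (τ : ℝ≥0∞) < d)
    (hU : (τ : ℝ≥0∞) < U) :
    ∃ t s : ℝ≥0, τ < t ∧ t < s ∧ (s : ℝ≥0∞) < U ∧ ⌊t⌋₊ = ⌊s⌋₊ ∧ ⌊s⌋₊ < d := by
  have hfl : (τ : ℝ≥0∞) < ((⌊τ⌋₊ + 1 : ℝ≥0) : ℝ≥0∞) :=
    ENNReal.coe_lt_coe.2 (Nat.lt_floor_add_one τ)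
  obtain ⟨s, hτs, hs⟩ := ENNReal.lt_iff_exists_nnreal_btwn.1 (lt_min hU hfl)
  rw [ENNReal.coe_lt_coe] at hτs
  obtain ⟨t, hτt, hts⟩ := exists_between hτs
  have hs1 : s < ⌊τ⌋₊ + 1 := ENNReal.coe_lt_coe.1 (hs.trans_le (min_le_right _ _))
  have key : ∀ q : ℝ≥0, τ ≤ q → q ≤ s → ⌊q⌋₊ = ⌊τ⌋₊ := fun q h1 h2 =>
    (Nat.floor_eq_iff zero_le).2 ⟨(Nat.floor_le zero_le).trans h1, h2.trans_lt hs1⟩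
  refine ⟨t, s, hτt, hts, hs.trans_le (min_le_left _ _), ?_, ?_⟩
  · rw [key t hτt.le hts.le, key s hτs.le le_rfl]
  · rw [key s hτs.le le_rfl, Nat.floor_lt zero_le]
    exact_mod_cast hd

theorem range_codingMap_subset {ι : Type*} {A : ι → GL (Fin d) ℝ} {α : ℝ} (hα0 : 0 ≤ α)
    (hα1 : α < 1)
    (hα : ∀ i u, ‖Matrix.toEuclideanLin (A i : Matrix (Fin d) (Fin d) ℝ) u‖ ≤ α * ‖u‖)
    (J : Finset ι) (v : ι → EuclideanSpace ℝ (Fin d)) :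
    Set.range (codingMap (fun i : J => A i) (J.restrict v)) ⊆ selfAffineSet A v := by
  rintro _ ⟨x, rfl⟩
  exact ⟨fun k => x k, fun y =>
    tendsto_iterComp_codingMap (A := fun i : J => A i) hα0 hα1 (fun i => hα i) (J.restrict v) x y⟩

/-- The coded points of the subsystem depend only on the translations indexed by `J`, whose joint
law under the infinite product is the finite product measure. -/
theorem ae_le_dimH_selfAffineSet {ι : Type*} {A : ι → GL (Fin d) ℝ} {α : ℝ} (hα0 : 0 ≤ α)
    (hα1 : α < 1 / 2)
    (hα : ∀ i u, ‖Matrix.toEuclideanLin (A i : Matrix (Fin d) (Fin d) ℝ) u‖ ≤ α * ‖u‖)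
    {J : Finset ι} (hJ : J.Nonempty) {τ : ℝ≥0} (hd : (τ : ℝ≥0∞) < d)
    (hU : (τ : ℝ≥0∞) < upperAffinityDim fun i : J => A i) :
    ∀ᵐ v ∂(translationMeasure d ι), (τ : ℝ≥0∞) ≤ dimH (selfAffineSet A v) := by
  rcases eq_or_ne τ 0 with rfl | hτ
  · simp
  obtain ⟨t, s, hτt, hts, hsU, hfl, hs⟩ := exists_between_same_floor hd hU
  let : MeasurableSpace J := ⊤
  have : Nonempty J := hJ.to_subtype
  have h := ae_le_dimH_range_codingMap (A := fun i : J => A i) hα0 hα1 (fun i => hα i) hs hfl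
    (pos_iff_ne_zero.2 hτ) hτt hts (not_pressure_neg_of_lt_upperAffinityDim hsU)
  have hmap : (translationMeasure d ι).map J.restrict = Measure.pi fun _ : J => cubeMeasure d :=
    Measure.infinitePi_map_restrict (fun _ : ι => cubeMeasure d)
  rw [← hmap] at h
  filter_upwards [ae_of_ae_map (Finset.measurable_restrict J).aemeasurable h] with v hv
  exact hv.trans (dimH_mono (range_codingMap_subset hα0 (by linarith) hα J v))

theorem norm_toEuclideanLin_le {ι : Type*} {A : ι → GL (Fin d) ℝ} {a : ℝ≥0∞} (ha : a ≠ ∞)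
    (h : ∀ i, ‖Matrix.toEuclideanCLM (n := Fin d) (𝕜 := ℝ)
      (A i : Matrix (Fin d) (Fin d) ℝ)‖ₑ ≤ a) (i : ι) (u : EuclideanSpace ℝ (Fin d)) :
    ‖Matrix.toEuclideanLin (A i : Matrix (Fin d) (Fin d) ℝ) u‖ ≤ a.toReal * ‖u‖ := by
  have h1 := (Matrix.toEuclideanCLM (n := Fin d) (𝕜 := ℝ)
    (A i : Matrix (Fin d) (Fin d) ℝ)).le_opNorm u
  refine h1.trans ?_
  gcongr
  simpa using ENNReal.toReal_mono ha (h i)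

end Reduction

end SelfAffine

end

theorem mainTheorem12 {d : ℕ} {ι : Type*} [Countable ι] [Nonempty ι]
    (A : ι → GL (Fin d) ℝ)
    (hA : (⨆ i, ‖Matrix.toEuclideanCLM (n := Fin d) (𝕜 := ℝ)
      (A i : Matrix (Fin d) (Fin d) ℝ)‖ₑ) < (1 / 2 : ℝ≥0∞)) :
    ∀ᵐ v ∂(SelfAffine.translationMeasure d ι),
      min (d : ℝ≥0∞) (SelfAffine.lowerAffinityDim A) ≤ dimH (SelfAffine.selfAffineSet A v) := by
  have hα := SelfAffine.norm_toEuclideanLin_le hA.ne_top fun i => le_iSup (fun i =>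
    ‖Matrix.toEuclideanCLM (n := Fin d) (𝕜 := ℝ) (A i : Matrix (Fin d) (Fin d) ℝ)‖ₑ) i
  have hα1 : (⨆ i, ‖Matrix.toEuclideanCLM (n := Fin d) (𝕜 := ℝ)
      (A i : Matrix (Fin d) (Fin d) ℝ)‖ₑ).toReal < 1 / 2 := by
    have := (ENNReal.toReal_lt_toReal hA.ne_top (by simp)).2 hA
    simpa using this
  -- Restricting to rational exponents and finite subsets leaves countably many conditions, so a
  -- single null set serves them all.
  have key : ∀ᵐ v ∂(SelfAffine.translationMeasure d ι), ∀ (J : Finset ι) (q : ℚ),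
      J.Nonempty → ((Real.toNNReal q : ℝ≥0) : ℝ≥0∞) < d →
      ((Real.toNNReal q : ℝ≥0) : ℝ≥0∞) < SelfAffine.upperAffinityDim (fun i : J => A i) →
      ((Real.toNNReal q : ℝ≥0) : ℝ≥0∞) ≤ dimH (SelfAffine.selfAffineSet A v) := by
    simp only [ae_all_iff]
    exact fun J q hJ hd hU =>
      SelfAffine.ae_le_dimH_selfAffineSet ENNReal.toReal_nonneg hα1 hα hJ hd hU
  filter_upwards [key] with v hv
  by_contra! hlt
  obtain ⟨q, _, hq1, hq2⟩ := ENNReal.lt_iff_exists_rat_btwn.1 hlt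
  rw [lt_min_iff, SelfAffine.lowerAffinityDim] at hq2
  obtain ⟨hqd, hqU⟩ := hq2
  simp only [lt_iSup_iff] at hqU
  obtain ⟨J, hJ, hqJ⟩ := hqU
  exact absurd (hv J q hJ hqd hqJ) (not_le.2 hq1)
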